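/- **Setting.** Let $\Delta_k\subset\mathbb R^k$ be the set of probability distributions on $[k]$. For $x\in\mathbb R^k$ let $[x]_s$ keep the $s$ largest entries of $x$ in absolute value; $x$ is $s$-sparse if it has at most $s$ nonzero entries and $(s,\lambda)$-sparse if $\|x-[x]_s\|_1\le\lambda$. A matrix $B$ is $(s,\theta)$-RIP if $(1-\theta)\|x\|_2\le\|Bx\|_2\le(1+\theta)\|x\|_2$ for all $s$-sparse $x$. A mechanism $Q(y\mid x)$ (a probability distribution in $y$ for every $x$) is $\varepsilon$-LDP if $Q(y\mid x)\le e^{\varepsilon}Q(y\mid x')$ for all $x,x',y$. A *recovery procedure* $R$ maps a matrix $B$, a vector $y$ and a sparsity $s$ to a vector; it is *stable with constants $C,D$* if for every $s\ge1$ and every $(2s,1/\sqrt2)$-RIP matrix $B$, $\|x-R(B,Bx+e,s)\|_2\le\frac{C}{\sqrt s}\|x-[x]_s\|_1+D\|e\|_2$ for all $x,e$. **The method** (given $R$, $s$, $\varepsilon$ and $A\in\{-1,+1\}^{m\times k}$). Let $n_x$ be the number of $+1$'s in column $x$ of $A$. Each user holding $X_i\in[k]$ sends $Y_i\in[m]$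 drawn from $$Q(y\mid x)=\frac{e^\varepsilon}{n_xe^\varepsilon+m-n_x}\ \text{ if }A_{yx}=+1,\qquad Q(y\mid x)=\frac{1}{n_xe^\varepsilon+m-n_x}\ \text{ otherwise.}$$ From the empirical distribution $\hat q\in\mathbb R^m$ of $Y_1,\dots,Y_n$ the server forms $y=\frac{2e^\varepsilon-1}{(e^\varepsilon-1)^{3/2}}\bigl(\sqrt m\,\hat q-\mathbf 1/\sqrt m\bigr)$ and $B=\frac1{\sqrt m}\frac{A-\mu}{\sigma}$, where $\mu=2e^{-\varepsilon}-1$ and $\sigma=\sqrt{1-\mu^2}$, computes $f=R(B,y,s)$, and outputs the Euclidean projection $\hat p$ of $D'^{-1}f$ onto $\Delta_k$, where $D'=\operatorname{diag}_i\frac{m(2-e^{-\varepsilon})}{n_ie^\varepsilon+m-n_i}$. **Theorem.** There are a recovery procedure $R$ and constants $C,D>0$ such that $R$ is stable with constants $C,D$ and the following holds. For every $\eta\in(0,\tfrac12]$ there are constants $K,L,M>0$ such that for all integers $m$ and $1\le s\le k$, all $\delta\in(0,1)$, $\alpha\in(0,2]$, and all $\varepsilon$ with $1-\eta\le\varepsilon\le\log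 m$ (in particular for $1\le\varepsilon\le\log m$): let $A\in\{-1,+1\}^{m\times k}$ have i.i.d. entries equal to $+1$ with probability $e^{-\varepsilon}$ and $-1$ otherwise, and let $$m\ \ge\ K\max\Bigl\{\frac{e^\varepsilon\log(k/\delta)}{\varepsilon^2},\ \frac{e^\varepsilon\log(k/\delta)}{c^2\alpha^2},\ s\log\frac ks\Bigr\}.$$ * ($\ell_2$ error) If $c=1$, then with probability at least $1-\delta-e^{-m}$ over $A$: $Q$ is $(\varepsilon+\eta)$-LDP, each user's message can be encoded with $\lceil\log_2 m\rceil$ bits, and for all $n\ge L\,\frac{m}{e^\varepsilon\alpha^2}$, if $X_1,\dots,X_n$ are i.i.d. from $p\in\Delta_k$, then $\mathbb E\|p-\hat p\|_2\le\alpha$ for every $s$-sparse $p$, and $\mathbb E\|p-\hat p\|_2\le M\alpha$ for every $(s,\sqrt s\,\alpha)$-sparse $p$. * ($\ell_1$ error) If $c=1/\sqrt s$, then with probability at least $1-\delta-e^{-m}$ over $A$: $Q$ is $(\varepsilon+\eta)$-LDP, each user's message can be encoded with $\lceil\log_2 m\rceil$ bits, and for all $n\ge L\,\frac{sm}{e^\varepsilon\alpha^2}$,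 if $X_1,\dots,X_n$ are i.i.d. from $p\in\Delta_k$, then $\mathbb E\|p-\hat p\|_1\le\alpha$ for every $s$-sparse $p$, and $\mathbb E\|p-\hat p\|_1\le M\alpha$ for every $(s,\alpha)$-sparse $p$. (Running the method with $\varepsilon-\eta$ in place of $\varepsilon\ge1$ gives exact $\varepsilon$-LDP and changes the bounds only by constant factors.) -/

import Mathlib

open scoped BigOperators Matrix
open MeasureTheory

noncomputable section

namespace CompressivePrivatization

/-! ### Vectors, sparsity, distances -/

/-- The set `Δ_k` of `k`-ary distributions, inside `ℝ^k` with the Euclidean norm. -/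
def simplex (k : ℕ) : Set (EuclideanSpace ℝ (Fin k)) :=
  {p | (∀ i, 0 ≤ p i) ∧ ∑ i, p i = 1}

/-- `x` has at most `s` nonzero entries. -/
def IsSparse {k : ℕ} (s : ℕ) (x : EuclideanSpace ℝ (Fin k)) : Prop :=
  (Finset.univ.filter fun i => x i ≠ 0).card ≤ s

/-- `‖x - [x]_s‖₁`: the `ℓ₁` mass of `x` left after removing its `s` largest entries, that is, the
smallest `ℓ₁` mass left after removing at most `s` entries. -/
def tailMass {k : ℕ} (s : ℕ) (x : EuclideanSpace ℝ (Fin k)) : ℝ :=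
  ⨅ T : {T : Finset (Fin k) // T.card ≤ s}, ∑ i ∈ (T : Finset (Fin k))ᶜ, |x i|

/-- `x` is approximately `(s, lam)`-sparse. -/
def IsApproxSparse {k : ℕ} (s : ℕ) (lam : ℝ) (x : EuclideanSpace ℝ (Fin k)) : Prop :=
  tailMass s x ≤ lam

/-- `ℓ₁` distance. -/
def dist1 {k : ℕ} (x y : EuclideanSpace ℝ (Fin k)) : ℝ := ∑ i, |x i - y i|

/-- `ℓ₂` distance. -/
def dist2 {k : ℕ} (x y : EuclideanSpace ℝ (Fin k)) : ℝ := ‖x - y‖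

/-- The matrix-vector product between Euclidean spaces. -/
def app {m k : ℕ} (B : Matrix (Fin m) (Fin k) ℝ) (x : EuclideanSpace ℝ (Fin k)) :
    EuclideanSpace ℝ (Fin m) :=
  WithLp.toLp 2 fun i => ∑ j, B i j * x j

/-! ### Compressive sensing -/

/-- The restricted isometry property `(s, δ)`-RIP. -/
def RIP {m k : ℕ} (s : ℕ) (δ : ℝ) (B : Matrix (Fin m) (Fin k) ℝ) : Prop :=
  ∀ x : EuclideanSpace ℝ (Fin k), IsSparse s x →
    (1 - δ) * ‖x‖ ≤ ‖app B x‖ ∧ ‖app B x‖ ≤ (1 + δ) * ‖x‖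

/-- A sparse recovery procedure, for all sizes at once: it is given the measurement matrix `B`, the
measurement `y` and the target sparsity `s`, and outputs a vector. -/
abbrev Recovery : Type :=
  (m k : ℕ) → Matrix (Fin m) (Fin k) ℝ → EuclideanSpace ℝ (Fin m) → ℕ → EuclideanSpace ℝ (Fin k)

/-- Stable and robust recovery with constants `C`, `D`: whenever `B` is `(2s, 1/√2)`-RIP, the output
on `y = B x + e` is within `(C/√s) ‖x - [x]_s‖₁ + D ‖e‖₂` of `x`. -/
def Recovery.IsStable (R : Recovery) (C D : ℝ) : Prop :=
  ∀ (m k s : ℕ), 1 ≤ s → ∀ B : Matrix (Fin m) (Fin k) ℝ, RIP (2 * s) (1 / √2) B →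
    ∀ (x : EuclideanSpace ℝ (Fin k)) (e : EuclideanSpace ℝ (Fin m)),
      ‖x - R m k B (app B x + e) s‖ ≤ C / √(s : ℝ) * tailMass s x + D * ‖e‖

/-! ### The privatization mechanism -/

/-- The number `n_x` of entries `+1` in column `x`, i.e. the size of `C_x = {j | A j x = 1}`. -/
def colCount {m k : ℕ} (A : Matrix (Fin m) (Fin k) ℝ) (x : Fin k) : ℕ :=
  (Finset.univ.filter fun j => A j x = 1).card

/-- `n_x e^ε + m - n_x`. -/
def colWeight {m k : ℕ} (ε : ℝ) (A : Matrix (Fin m) (Fin k) ℝ) (x : Fin k) : ℝ :=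
  colCount A x * Real.exp ε + m - colCount A x

open Classical in
/-- The mechanism `Q(y | x)` defined by `A` and `ε`. -/
def channel {m k : ℕ} (ε : ℝ) (A : Matrix (Fin m) (Fin k) ℝ) (x : Fin k) (y : Fin m) : ℝ :=
  if A y x = 1 then Real.exp ε / colWeight ε A x else 1 / colWeight ε A x

/-- `Q` is a mechanism (each `Q(· | x)` is a probability distribution) and it is `ε`-locally
differentially private. -/
def IsLDP {X Y : Type} [Fintype Y] (Q : X → Y → ℝ) (ε : ℝ) : Prop :=
  (∀ x y, 0 ≤ Q x y) ∧ (∀ x, ∑ y, Q x y = 1) ∧ ∀ x x' y, Q x y ≤ Real.exp ε * Q x' y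

/-- The elements of `Y` can be told apart by messages of `b` bits. -/
def FitsInBits (Y : Type) (b : ℕ) : Prop :=
  ∃ enc : Y → (Fin b → Bool), Function.Injective enc

/-! ### The estimator -/

/-- The empirical distribution `q̂` of the privatized samples. -/
def empirical {m n : ℕ} (Y : Fin n → Fin m) : EuclideanSpace ℝ (Fin m) :=
  WithLp.toLp 2 fun i => ((Finset.univ.filter fun j => Y j = i).card : ℝ) / n

/-- The mean of a random sign that is `+1` with probability `e^{-ε}` and `-1` otherwise. -/
def signMean (ε : ℝ) : ℝ := 2 * Real.exp (-ε) - 1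

/-- The standard deviation of that sign. -/
def signStd (ε : ℝ) : ℝ := √(1 - signMean ε ^ 2)

/-- The measurement matrix `B = (1/√m) (A - E[A]) / σ(A)`. -/
def sensing {m k : ℕ} (ε : ℝ) (A : Matrix (Fin m) (Fin k) ℝ) : Matrix (Fin m) (Fin k) ℝ :=
  fun i j => 1 / √(m : ℝ) * ((A i j - signMean ε) / signStd ε)

/-- The measurement `y = (2e^ε - 1)/(e^ε - 1)^{3/2} (√m q̂ - 1/√m)`. -/
def measurement {m : ℕ} (ε : ℝ) (q : EuclideanSpace ℝ (Fin m)) : EuclideanSpace ℝ (Fin m) :=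
  WithLp.toLp 2 fun i =>
    (2 * Real.exp ε - 1) / (Real.exp ε - 1) ^ (3 / 2 : ℝ) * (√(m : ℝ) * q i - 1 / √(m : ℝ))

/-- The diagonal entries of `D' = m (2 - e^{-ε}) diag(1 / (n_i e^ε + m - n_i))`. -/
def rescale {m k : ℕ} (ε : ℝ) (A : Matrix (Fin m) (Fin k) ℝ) (i : Fin k) : ℝ :=
  m * (2 - Real.exp (-ε)) / colWeight ε A i

/-- `w` is the Euclidean projection of `v` onto `Δ_k`. -/
def IsProj {k : ℕ} (v w : EuclideanSpace ℝ (Fin k)) : Prop :=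
  w ∈ simplex k ∧ ∀ z ∈ simplex k, ‖v - w‖ ≤ ‖v - z‖

theorem exists_isProj {k : ℕ} (hk : 1 ≤ k) (v : EuclideanSpace ℝ (Fin k)) : ∃ w, IsProj v w := by
  have hcl : IsClosed (simplex k) := by
    have h1 : IsClosed {p : EuclideanSpace ℝ (Fin k) | ∀ i, 0 ≤ p i} := by
      simp only [Set.ofPred_forall]
      exact isClosed_iInter fun i => isClosed_le continuous_const (by fun_prop)
    have h2 : IsClosed {p : EuclideanSpace ℝ (Fin k) | ∑ i, p i = 1} :=
      isClosed_eq (by fun_prop) continuous_const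
    exact h1.inter h2
  have hne : (simplex k).Nonempty := by
    refine ⟨WithLp.toLp 2 fun i => if i = ⟨0, hk⟩ then 1 else 0, ?_, ?_⟩
    · intro i
      dsimp only
      split_ifs <;> norm_num
    · simp
  obtain ⟨w, hw, hd⟩ := hcl.exists_infDist_eq_dist hne v
  refine ⟨w, hw, fun z hz => ?_⟩
  rw [← dist_eq_norm, ← dist_eq_norm, ← hd]
  exact Metric.infDist_le_dist_of_mem hz

/-- The Euclidean projection onto `Δ_k`; it exists for `k ≥ 1` by `exists_isProj`. -/
def projSimplex {k : ℕ} (v : EuclideanSpace ℝ (Fin k)) : EuclideanSpace ℝ (Fin k) :=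
  Classical.epsilon (IsProj v)

/-- The estimator `p̂`: recover `f` from the measurement, then project `D'⁻¹ f` onto `Δ_k`. -/
def estimator (R : Recovery) {m k n : ℕ} (s : ℕ) (ε : ℝ) (A : Matrix (Fin m) (Fin k) ℝ)
    (Y : Fin n → Fin m) : EuclideanSpace ℝ (Fin k) :=
  let f := R m k (sensing ε A) (measurement ε (empirical Y)) s
  projSimplex (WithLp.toLp 2 fun i => (rescale ε A i)⁻¹ * f i)

/-- `E[d(p, p̂(Y_1, …, Y_n))]`, where `X_1, …, X_n` are i.i.d. samples of `p` and, independently for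
each `i`, `Y_i` is drawn from `Q(· | X_i)`. -/
def expectedError (R : Recovery) {m k : ℕ} (s : ℕ) (ε : ℝ) (A : Matrix (Fin m) (Fin k) ℝ)
    (d : EuclideanSpace ℝ (Fin k) → EuclideanSpace ℝ (Fin k) → ℝ)
    (p : EuclideanSpace ℝ (Fin k)) (n : ℕ) : ℝ :=
  ∑ X : Fin n → Fin k, ∑ Y : Fin n → Fin m,
    (∏ i, p (X i) * channel ε A (X i) (Y i)) * d p (estimator R s ε A Y)

/-- With at least `N` samples the expected error is at most `a`, for every distribution in `P`. -/
def Achieves (R : Recovery) {m k : ℕ} (s : ℕ) (ε : ℝ) (A : Matrix (Fin m) (Fin k) ℝ)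
    (d : EuclideanSpace ℝ (Fin k) → EuclideanSpace ℝ (Fin k) → ℝ)
    (P : EuclideanSpace ℝ (Fin k) → Prop) (N a : ℝ) : Prop :=
  ∀ p ∈ simplex k, P p → ∀ n : ℕ, N ≤ n → expectedError R s ε A d p n ≤ a

/-! ### The random matrix -/

/-- The law of an entry: `+1` with probability `e^{-ε}`, `-1` otherwise. -/
def signLaw (ε : ℝ) : Measure ℝ :=
  ENNReal.ofReal (Real.exp (-ε)) • Measure.dirac 1 +
    ENNReal.ofReal (1 - Real.exp (-ε)) • Measure.dirac (-1)

/-- The law of an `m × k` matrix with i.i.d. entries of law `signLaw ε`. -/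
def matrixLaw (m k : ℕ) (ε : ℝ) : Measure (Fin m → Fin k → ℝ) :=
  Measure.pi fun _ => Measure.pi fun _ => signLaw ε

/-- `max {e^ε log(k/δ)/ε², e^ε log(k/δ)/(c²α²), s log(k/s)}`. -/
def dimBound (k s : ℕ) (ε δ α c : ℝ) : ℝ :=
  max (max (Real.exp ε * Real.log (k / δ) / ε ^ 2)
      (Real.exp ε * Real.log (k / δ) / (c ^ 2 * α ^ 2)))
    (s * Real.log (k / s))

end CompressivePrivatization

end

open CompressivePrivatization

noncomputable section

namespace CompressivePrivatization

/-! ### Expectations over finite products -/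

/-! The privatized samples are i.i.d. from a law `q` on the rows, and the gain and `D'` are chosen
so that the measurement equals `B (D' p)` plus two errors: sampling noise of size about `√(e^{-ε} m)
‖q̂ - q‖`, where `E ‖q̂ - q‖² ≤ 1/n`, and a bias that vanishes when every column of `A` has exactly
`m e^{-ε}` entries `+1` (`measurement_sub_app`). Chernoff's bound makes the column counts accurate
up to a small relative error `ρ`. This gives privacy, makes `D'` nearly the identity, and bounds the
bias by a multiple of `ρ`.

Inverting `B` requires only the one-sided property `NullSpaceProp`. Normalized entries have fourth
moment at most about `e^ε`. Since `‖B x‖²` is an average of nonnegative variables, its lower tail is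
controlled by these fourth moments and fails with probability at most `exp(-m e^{-ε}/48)` for fixed
`x` (`prodExp_lower_tail`). A union bound treats all sums of `d` signed basis vectors, and Maurey's
empirical method passes from these sums to all vectors (`lower_bound_of_signedBasis`). This yields
the null space property at every level `t` with `t log k ≲ m e^{-ε}`.

With `β = cα`, the middle term of `dimBound` gives `m e^{-ε} ≳ log(k/δ)/β²`, so the level `t =
min(s, ⌈1920²/β²⌉)` is reached. If `t < s`, this is still enough: a distribution has `ℓ₁` mass `1`,
so its tail contributes at most `1/√t ≤ β/1920`. In the `ℓ₁` case `β = α/√s` and the level is `s`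
itself. The recovery procedure therefore works at the largest level up to `s` with the null space
property. A `(2s, 1/√2)`-RIP matrix has the property at level `s` (`nullSpaceProp_of_RIP`), so the
procedure is stable. -/

/-- The expectation of `F` when the `n` coordinates are independent with weights `w`. -/
def prodExp {Ω : Type*} [Fintype Ω] {n : ℕ} (w : Ω → ℝ) (F : (Fin n → Ω) → ℝ) : ℝ :=
  ∑ f : Fin n → Ω, (∏ i, w (f i)) * F f

section ProdExp

variable {Ω : Type*} [Fintype Ω] {n : ℕ} {w : Ω → ℝ}

theorem prodExp_succ (F : (Fin (n + 1) → Ω) → ℝ) :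
    prodExp w F = ∑ a, w a * prodExp w fun f : Fin n → Ω => F (Fin.cons a f) := by
  unfold prodExp
  rw [← (Fin.consEquiv fun _ : Fin (n + 1) => Ω).sum_comp, Fintype.sum_prod_type]
  refine Finset.sum_congr rfl fun a _ => ?_
  rw [Finset.mul_sum]
  refine Finset.sum_congr rfl fun f _ => ?_
  simp [Fin.consEquiv, Fin.prod_univ_succ, mul_assoc]

theorem prodExp_prod (g : Fin n → Ω → ℝ) :
    prodExp w (fun f => ∏ i, g i (f i)) = ∏ i, ∑ a, w a * g i a := by
  classical
  rw [Finset.prod_univ_sum]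
  simp [prodExp, Finset.prod_mul_distrib]

theorem prodExp_add (F G : (Fin n → Ω) → ℝ) :
    prodExp w (fun f => F f + G f) = prodExp w F + prodExp w G := by
  simp [prodExp, mul_add, Finset.sum_add_distrib]

theorem prodExp_const_mul (c : ℝ) (F : (Fin n → Ω) → ℝ) :
    prodExp w (fun f => c * F f) = c * prodExp w F := by
  simp only [prodExp, Finset.mul_sum]
  exact Finset.sum_congr rfl fun f _ => by ring

theorem prodExp_const (hw : ∑ a, w a = 1) (c : ℝ) :
    prodExp w (fun _ : Fin n → Ω => c) = c := by
  have h := prodExp_prod (w := w) (n := n) fun _ _ => 1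
  have h2 := prodExp_const_mul (w := w) (n := n) c fun _ => 1
  simp only [Finset.prod_const_one, mul_one, hw] at h h2
  rw [h2, h, mul_one]

theorem prodExp_mono (hw : ∀ a, 0 ≤ w a) {F G : (Fin n → Ω) → ℝ} (h : ∀ f, F f ≤ G f) :
    prodExp w F ≤ prodExp w G :=
  Finset.sum_le_sum fun f _ =>
    mul_le_mul_of_nonneg_left (h f) (Finset.prod_nonneg fun i _ => hw (f i))

theorem prodExp_sum {ι : Type*} (s : Finset ι) (F : ι → (Fin n → Ω) → ℝ) :
    prodExp w (fun f => ∑ i ∈ s, F i f) = ∑ i ∈ s, prodExp w (F i) := by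
  simp only [prodExp, Finset.mul_sum]
  exact Finset.sum_comm

theorem sum_prod_weights (hw : ∑ a, w a = 1) : ∑ f : Fin n → Ω, ∏ i, w (f i) = 1 := by
  simpa [prodExp] using prodExp_const (n := n) hw 1

/-! ### Second moments of sums of i.i.d. vectors. -/

section SecondMoment

variable {E : Type*} [NormedAddCommGroup E] [InnerProductSpace ℝ E]

theorem prodExp_inner_sum (hw : ∑ a, w a = 1) (u : Ω → E) (v : E) :
    prodExp w (fun f : Fin n → Ω => inner ℝ v (∑ i, u (f i))) =
      n * inner ℝ v (∑ a, w a • u a) := by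
  induction n with
  | zero => simp [prodExp]
  | succ n ih =>
    rw [prodExp_succ]
    simp only [Fin.sum_univ_succ, Fin.cons_zero, Fin.cons_succ, inner_add_right, prodExp_add, ih,
      prodExp_const hw, mul_add, Finset.sum_add_distrib, ← Finset.sum_mul, hw]
    rw [inner_sum]
    simp only [inner_smul_right]
    push_cast
    ring

/-- The `n` diagonal terms give second moments and the `n(n-1)` off-diagonal ones factor by
independence. It serves both Maurey's method and the sampling noise of `q̂`. -/
theorem prodExp_norm_sum_sq (hw : ∑ a, w a = 1) (u : Ω → E) :
    prodExp w (fun f : Fin n → Ω => ‖∑ i, u (f i)‖ ^ 2) =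
      n * ∑ a, w a * ‖u a‖ ^ 2 + n * (n - 1) * ‖∑ a, w a • u a‖ ^ 2 := by
  induction n with
  | zero => simp [prodExp]
  | succ n ih =>
    rw [prodExp_succ]
    simp only [Fin.sum_univ_succ, Fin.cons_zero, Fin.cons_succ, norm_add_sq_real, prodExp_add, ih,
      prodExp_const hw, prodExp_const_mul, prodExp_inner_sum hw, mul_add, Finset.sum_add_distrib,
      ← Finset.sum_mul, hw]
    have h : ∑ a, w a * (2 * (n * inner ℝ (u a) (∑ a, w a • u a))) =
        2 * n * ‖∑ a, w a • u a‖ ^ 2 := by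
      rw [← real_inner_self_eq_norm_sq, sum_inner, Finset.mul_sum]
      simp only [real_inner_smul_left]
      exact Finset.sum_congr rfl fun a _ => by ring
    rw [h]
    push_cast
    ring

end SecondMoment

/-! ### Moments of linear forms in independent centred variables. -/

section FourthMoment

variable {z : Ω → ℝ}

theorem prodExp_linear (hw : ∑ a, w a = 1) (hz : ∑ a, w a * z a = 0) (x : Fin n → ℝ) :
    prodExp w (fun f => ∑ i, x i * z (f i)) = 0 := by
  induction n with
  | zero => simp [prodExp]
  | succ n ih =>
    rw [prodExp_succ]
    simp only [Fin.sum_univ_succ, Fin.cons_zero, Fin.cons_succ, prodExp_add, ih,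
      prodExp_const hw, add_zero]
    rw [← mul_zero (x 0), ← hz, Finset.mul_sum]
    exact Finset.sum_congr rfl fun a _ => by ring

theorem prodExp_linear_sq (hw : ∑ a, w a = 1) (hz : ∑ a, w a * z a = 0)
    (hz2 : ∑ a, w a * z a ^ 2 = 1) (x : Fin n → ℝ) :
    prodExp w (fun f => (∑ i, x i * z (f i)) ^ 2) = ∑ i, x i ^ 2 := by
  induction n with
  | zero => simp [prodExp]
  | succ n ih =>
    have key : ∀ a : ℝ, prodExp w (fun f : Fin n → Ω => (a + ∑ i, x i.succ * z (f i)) ^ 2) =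
        a ^ 2 + ∑ i : Fin n, x i.succ ^ 2 := by
      intro a
      have h1 : (fun f : Fin n → Ω => (a + ∑ i, x i.succ * z (f i)) ^ 2) = fun f =>
          (a ^ 2 + 2 * a * ∑ i, x i.succ * z (f i)) + (∑ i, x i.succ * z (f i)) ^ 2 := by
        funext f; ring
      rw [h1, prodExp_add, prodExp_add, prodExp_const hw, prodExp_const_mul,
        prodExp_linear hw hz fun i => x (Fin.succ i), ih fun i => x (Fin.succ i)]
      ring
    rw [prodExp_succ]
    simp only [Fin.sum_univ_succ, Fin.cons_zero, Fin.cons_succ, key, mul_add,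
      Finset.sum_add_distrib, ← Finset.sum_mul, hw, one_mul, add_left_inj]
    rw [← mul_one (x 0 ^ 2), ← hz2, Finset.mul_sum]
    exact Finset.sum_congr rfl fun a _ => by ring

/-- When `(a + S)^4` is expanded, centring removes the terms odd in the new variable, including the
third moment of `S`. The cross term `6 x₀² N` fits into `2 (3 + κ) x₀² N`. -/
theorem prodExp_linear_pow_four (hw : ∑ a, w a = 1) (hz : ∑ a, w a * z a = 0)
    (hz2 : ∑ a, w a * z a ^ 2 = 1) {κ : ℝ} (hκ : 0 ≤ κ) (hz4 : ∑ a, w a * z a ^ 4 ≤ κ)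
    (x : Fin n → ℝ) :
    prodExp w (fun f => (∑ i, x i * z (f i)) ^ 4) ≤ (3 + κ) * (∑ i, x i ^ 2) ^ 2 := by
  induction n with
  | zero => simp [prodExp]
  | succ n ih =>
    set S : (Fin n → Ω) → ℝ := fun f => ∑ i, x (Fin.succ i) * z (f i) with hS
    set N := ∑ i : Fin n, x i.succ ^ 2 with hN
    have hN0 : 0 ≤ N := Finset.sum_nonneg fun i _ => sq_nonneg _
    have e1 : prodExp w S = 0 := prodExp_linear hw hz fun i => x (Fin.succ i)
    have e2 : prodExp w (fun f => S f ^ 2) = N :=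
      prodExp_linear_sq hw hz hz2 fun i => x (Fin.succ i)
    have e4 : prodExp w (fun f => S f ^ 4) ≤ (3 + κ) * N ^ 2 := ih fun i => x (Fin.succ i)
    have key : ∀ a : ℝ, prodExp w (fun f => (a + S f) ^ 4) =
        a ^ 4 + 6 * a ^ 2 * N + 4 * a * prodExp w (fun f => S f ^ 3) +
          prodExp w fun f => S f ^ 4 := by
      intro a
      have h1 : (fun f => (a + S f) ^ 4) = fun f =>
          (((a ^ 4 + 4 * a ^ 3 * S f) + 6 * a ^ 2 * S f ^ 2) + 4 * a * S f ^ 3) + S f ^ 4 := by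
        funext f; ring
      rw [h1, prodExp_add, prodExp_add, prodExp_add, prodExp_add, prodExp_const hw,
        prodExp_const_mul, prodExp_const_mul, prodExp_const_mul, e1, e2]
      ring
    have total : prodExp w (fun f : Fin (n + 1) → Ω => (∑ i, x i * z (f i)) ^ 4) =
        x 0 ^ 4 * ∑ a, w a * z a ^ 4 + 6 * x 0 ^ 2 * N + prodExp w fun f => S f ^ 4 := by
      rw [prodExp_succ]
      simp only [Fin.sum_univ_succ, Fin.cons_zero, Fin.cons_succ]
      change ∑ a, w a * prodExp w (fun f => (x 0 * z a + S f) ^ 4) = _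
      simp only [key]
      have h2 : ∀ a, w a * ((x 0 * z a) ^ 4 + 6 * (x 0 * z a) ^ 2 * N +
          4 * (x 0 * z a) * prodExp w (fun f => S f ^ 3) + prodExp w fun f => S f ^ 4) =
          x 0 ^ 4 * (w a * z a ^ 4) + 6 * x 0 ^ 2 * N * (w a * z a ^ 2) +
            4 * x 0 * prodExp w (fun f => S f ^ 3) * (w a * z a) +
            (prodExp w fun f => S f ^ 4) * w a := fun a => by ring
      simp only [h2, Finset.sum_add_distrib, ← Finset.mul_sum, hw, hz, hz2]
      ring
    rw [total, Fin.sum_univ_succ]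
    have h3 : x 0 ^ 4 * ∑ a, w a * z a ^ 4 ≤ x 0 ^ 4 * κ :=
      mul_le_mul_of_nonneg_left hz4 (by positivity)
    have h4 : 0 ≤ κ * (x 0 ^ 2 * N) := by positivity
    nlinarith [sq_nonneg (x 0 ^ 2)]

end FourthMoment

/-- Chernoff's bound for a sum of independent variables. -/
theorem prodExp_chernoff (hw : ∀ a, 0 ≤ w a) (g : Ω → ℝ) {u : ℝ}
    (P : (Fin n → Ω) → Prop) [DecidablePred P] (hP : ∀ f, P f → u ≤ ∑ i, g (f i)) :
    prodExp w (fun f => if P f then 1 else 0) ≤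
      Real.exp (-u) * (∑ a, w a * Real.exp (g a)) ^ n := by
  have h := prodExp_prod (w := w) (n := n) fun _ a => Real.exp (g a)
  rw [Finset.prod_const, Finset.card_univ, Fintype.card_fin] at h
  rw [← h, ← prodExp_const_mul]
  refine prodExp_mono hw fun f => ?_
  rw [← Real.exp_sum, ← Real.exp_add]
  split_ifs with hf
  · exact Real.one_le_exp (by linarith [hP f hf])
  · positivity

end ProdExp

/-- This follows from `exp u ≥ 1 + u + u²/2` and `(1 + u²/2)² - u² = 1 + u⁴/4 ≥ 1`. -/
theorem exp_neg_le_quadratic {u : ℝ} (hu : 0 ≤ u) : Real.exp (-u) ≤ 1 - u + u ^ 2 / 2 := by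
  rw [Real.exp_neg]
  have h1 := Real.quadratic_le_exp_of_nonneg hu
  have h2 : 0 ≤ 1 - u + u ^ 2 / 2 := by nlinarith [sq_nonneg (u - 1)]
  rw [inv_le_iff_one_le_mul₀ (Real.exp_pos u)]
  nlinarith [mul_le_mul_of_nonneg_left h1 h2, sq_nonneg (u ^ 2)]

/-- Lower tail of an average of squares of linear forms with bounded fourth moment. -/
theorem prodExp_lower_tail {m k : ℕ} {Ω : Type*} [Fintype Ω] {w z : Ω → ℝ} (hw0 : ∀ a, 0 ≤ w a)
    (hw : ∑ a, w a = 1) (hz : ∑ a, w a * z a = 0) (hz2 : ∑ a, w a * z a ^ 2 = 1) {κ : ℝ}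
    (hκ : 0 ≤ κ) (hz4 : ∑ a, w a * z a ^ 4 ≤ κ) (x : Fin k → ℝ)
    (P : (Fin m → Fin k → Ω) → Prop) [DecidablePred P]
    (hP : ∀ f, P f → ∑ r, (∑ i, x i * z (f r i)) ^ 2 < m / 2 * ∑ i, x i ^ 2) :
    prodExp (fun row : Fin k → Ω => ∏ i, w (row i)) (fun f => if P f then 1 else 0) ≤
      Real.exp (-(m / (8 * (3 + κ)))) := by
  set N := ∑ i, x i ^ 2 with hN
  have hN0 : 0 ≤ N := Finset.sum_nonneg fun i _ => sq_nonneg _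
  have hrow : ∀ row : Fin k → Ω, 0 ≤ ∏ i, w (row i) :=
    fun row => Finset.prod_nonneg fun i _ => hw0 _
  rcases hN0.eq_or_lt with h0 | hpos
  · have hfalse : ∀ f, ¬ P f := fun f hf => by
      have := hP f hf
      rw [← h0, mul_zero] at this
      exact absurd this (not_lt.mpr (Finset.sum_nonneg fun r _ => sq_nonneg _))
    simp only [hfalse, if_false]
    simp only [prodExp, mul_zero, Finset.sum_const_zero]
    positivity
  · set c := 3 + κ with hc
    have hcpos : 0 < c := by positivity
    -- This `a` minimizes the exponent `a N / 2 - a N + a² c N² / 2` per row, whose minimum is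
    -- `-1/(8c)`.
    set a := 1 / (2 * c * N) with ha
    have hapos : 0 < a := by positivity
    have haN : a * N = 1 / (2 * c) := by rw [ha]; field_simp
    refine (prodExp_chernoff hrow (fun row => -(a * (∑ i, x i * z (row i)) ^ 2))
      (u := -(m / (4 * c))) P ?_).trans ?_
    · intro f hf
      rw [Finset.sum_neg_distrib, ← Finset.mul_sum, neg_le_neg_iff]
      refine (mul_le_mul_of_nonneg_left (hP f hf).le hapos.le).trans (le_of_eq ?_)
      rw [mul_left_comm, haN]
      field_simp
      norm_num
    · have hmgf : ∑ row : Fin k → Ω, (∏ i, w (row i)) *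
          Real.exp (-(a * (∑ i, x i * z (row i)) ^ 2)) ≤ Real.exp (-(3 / (8 * c))) := by
        have h1 : prodExp w (fun row : Fin k → Ω => Real.exp (-(a * (∑ i, x i * z (row i)) ^ 2))) ≤
            prodExp w (fun row : Fin k → Ω => (1 + (-a) * (∑ i, x i * z (row i)) ^ 2) +
              a ^ 2 / 2 * (∑ i, x i * z (row i)) ^ 4) := by
          refine prodExp_mono hw0 fun row => ?_
          refine (exp_neg_le_quadratic (by positivity)).trans (le_of_eq ?_)
          ring
        rw [prodExp_add, prodExp_add, prodExp_const hw, prodExp_const_mul, prodExp_const_mul,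
          prodExp_linear_sq hw hz hz2] at h1
        have h2 := mul_le_mul_of_nonneg_left (prodExp_linear_pow_four hw hz hz2 hκ hz4 x)
          (show 0 ≤ a ^ 2 / 2 by positivity)
        have h3 : a ^ 2 / 2 * ((3 + κ) * (∑ i, x i ^ 2) ^ 2) = 1 / (8 * c) := by
          have : a ^ 2 / 2 * ((3 + κ) * (∑ i, x i ^ 2) ^ 2) = (a * N) ^ 2 * c / 2 := by
            rw [hN, hc]; ring
          rw [this, haN]
          field_simp
          norm_num
        have h4 : -a * N = -(4 / (8 * c)) := by
          rw [neg_mul, haN]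
          field_simp
          norm_num
        have h5 := Real.add_one_le_exp (-(3 / (8 * c)))
        have h6 : (3 : ℝ) / (8 * c) = 4 / (8 * c) - 1 / (8 * c) := by ring
        refine h1.trans ?_
        rw [h3] at h2
        rw [← hN, h4]
        linarith
      refine (mul_le_mul_of_nonneg_left (pow_le_pow_left₀
        (Finset.sum_nonneg fun row _ => mul_nonneg (hrow row) (Real.exp_pos _).le) hmgf m)
        (Real.exp_pos _).le).trans (le_of_eq ?_)
      rw [← Real.exp_nat_mul, ← Real.exp_add]
      congr 1
      field_simp
      ring

/-! ### Matrices as linear maps -/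

/-- `app B` as a linear map. -/
def appLin {m k : ℕ} (B : Matrix (Fin m) (Fin k) ℝ) :
    EuclideanSpace ℝ (Fin k) →ₗ[ℝ] EuclideanSpace ℝ (Fin m) where
  toFun := app B
  map_add' x y := by
    ext i
    simp [app, mul_add, Finset.sum_add_distrib]
  map_smul' c x := by
    ext i
    simp [app, Finset.mul_sum, mul_left_comm]

theorem appLin_apply {m k : ℕ} (B : Matrix (Fin m) (Fin k) ℝ) (x : EuclideanSpace ℝ (Fin k)) :
    appLin B x = app B x := rfl

theorem app_sub {m k : ℕ} (B : Matrix (Fin m) (Fin k) ℝ) (x y : EuclideanSpace ℝ (Fin k)) :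
    app B (x - y) = app B x - app B y := (appLin B).map_sub x y

theorem norm_app_sq {m k : ℕ} (B : Matrix (Fin m) (Fin k) ℝ) (x : EuclideanSpace ℝ (Fin k)) :
    ‖app B x‖ ^ 2 = ∑ r, (∑ j, B r j * x j) ^ 2 := by
  simp [EuclideanSpace.real_norm_sq_eq, app]

/-! ### Averages of signed basis vectors -/

/-- The signed basis vector `± e_j`. -/
def signedBasis {k : ℕ} (a : Fin k × Bool) : EuclideanSpace ℝ (Fin k) :=
  EuclideanSpace.single a.1 (if a.2 then 1 else -1)

theorem norm_signedBasis {k : ℕ} (a : Fin k × Bool) : ‖signedBasis a‖ = 1 := by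
  unfold signedBasis
  split_ifs <;> simp

theorem norm_app_signedBasis_sq {m k : ℕ} (B : Matrix (Fin m) (Fin k) ℝ) (a : Fin k × Bool) :
    ‖app B (signedBasis a)‖ ^ 2 = ∑ r, B r a.1 ^ 2 := by
  rw [norm_app_sq]
  refine Finset.sum_congr rfl fun r _ => ?_
  rw [Finset.sum_eq_single a.1]
  · unfold signedBasis
    split_ifs <;> simp
  · intro j _ hj
    simp [signedBasis, hj]
  · simp

theorem isSparse_sum_signedBasis {k d : ℕ} (τ : Fin d → Fin k × Bool) :
    IsSparse d (∑ l, signedBasis (τ l)) := by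
  unfold IsSparse
  calc _ ≤ (Finset.univ.image fun l => (τ l).1).card := by
        refine Finset.card_le_card fun i hi => ?_
        simp only [Finset.mem_filter, Finset.mem_univ, true_and] at hi
        by_contra hn
        apply hi
        rw [WithLp.ofLp_sum, Finset.sum_apply]
        refine Finset.sum_eq_zero fun l _ => ?_
        have : i ≠ (τ l).1 := fun h => hn (by simp [h])
        simp [signedBasis, this]
    _ ≤ d := Finset.card_image_le.trans (by simp)

/-- The weights of the signed basis vectors whose average is `x`. -/
def signedWeight {k : ℕ} (x : EuclideanSpace ℝ (Fin k)) (a : Fin k × Bool) : ℝ :=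
  if a.2 then max (x a.1) 0 else max (-x a.1) 0

theorem signedWeight_nonneg {k : ℕ} (x : EuclideanSpace ℝ (Fin k)) (a : Fin k × Bool) :
    0 ≤ signedWeight x a := by
  unfold signedWeight
  split_ifs <;> exact le_max_right _ _

theorem sum_signedWeight {k : ℕ} (x : EuclideanSpace ℝ (Fin k)) :
    ∑ a, signedWeight x a = ∑ i, |x i| := by
  rw [Fintype.sum_prod_type]
  refine Finset.sum_congr rfl fun i _ => ?_
  simp only [Fintype.sum_bool, signedWeight, if_true, Bool.false_eq_true, if_false]
  rcases le_total 0 (x i) with h | h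
  · rw [max_eq_left h, max_eq_right (by linarith), abs_of_nonneg h, add_zero]
  · rw [max_eq_right h, max_eq_left (by linarith), abs_of_nonpos h, zero_add]

theorem sum_signedWeight_smul {k : ℕ} (x : EuclideanSpace ℝ (Fin k)) :
    ∑ a, signedWeight x a • signedBasis a = x := by
  rw [Fintype.sum_prod_type]
  ext j
  rw [WithLp.ofLp_sum, Finset.sum_apply, Finset.sum_eq_single j]
  · simp only [Fintype.sum_bool, signedWeight, signedBasis, if_true, Bool.false_eq_true, if_false]
    simp only [PiLp.add_apply, PiLp.smul_apply, PiLp.single_apply, if_true, smul_eq_mul]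
    rcases le_total 0 (x j) with h | h
    · rw [max_eq_left h, max_eq_right (by linarith)]; ring
    · rw [max_eq_right h, max_eq_left (by linarith)]; ring
  · intro i _ hi
    simp [signedBasis, hi.symm]
  · simp

/-- Maurey's empirical method: second moments of sums of random signed basis vectors. -/
theorem prodExp_signedBasis {k d : ℕ} {F : Type*} [NormedAddCommGroup F] [InnerProductSpace ℝ F]
    (T : EuclideanSpace ℝ (Fin k) →ₗ[ℝ] F) {x : EuclideanSpace ℝ (Fin k)}
    (hx : ∑ i, |x i| = 1) :
    prodExp (signedWeight x) (fun τ : Fin d → Fin k × Bool => ‖T (∑ l, signedBasis (τ l))‖ ^ 2) =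
      d * ∑ a, signedWeight x a * ‖T (signedBasis a)‖ ^ 2 + d * (d - 1) * ‖T x‖ ^ 2 := by
  have h := prodExp_norm_sum_sq (n := d) ((sum_signedWeight x).trans hx)
    fun a => T (signedBasis a)
  have h2 : ∑ a, signedWeight x a • T (signedBasis a) = T x := by
    conv_rhs => rw [← sum_signedWeight_smul x]
    simp
  simpa only [← map_sum, h2] using h

/-- Both sides are homogeneous of degree two. -/
theorem quadratic_le_of_sum_abs_eq_one {m k : ℕ} {B : Matrix (Fin m) (Fin k) ℝ} {a b c : ℝ}
    (h : ∀ x : EuclideanSpace ℝ (Fin k), ∑ i, |x i| = 1 →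
      a * ‖x‖ ^ 2 + b * ‖app B x‖ ^ 2 ≤ c) (x : EuclideanSpace ℝ (Fin k)) :
    a * ‖x‖ ^ 2 + b * ‖app B x‖ ^ 2 ≤ c * (∑ i, |x i|) ^ 2 := by
  rcases (Finset.sum_nonneg fun i _ => abs_nonneg (x i) : 0 ≤ ∑ i, |x i|).eq_or_lt with h0 | hpos
  · have hx0 : x = 0 := by
      ext i
      exact abs_eq_zero.mp ((Finset.sum_eq_zero_iff_of_nonneg fun i _ => abs_nonneg (x i)).mp
        h0.symm i (Finset.mem_univ i))
    have : app B x = 0 := by rw [hx0]; exact (appLin B).map_zero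
    rw [this, hx0]
    simp
  · set N := ∑ i, |x i| with hN
    have h1 := h (N⁻¹ • x) (by
      simp only [PiLp.smul_apply, smul_eq_mul, abs_mul, ← Finset.mul_sum, ← hN]
      rw [abs_of_pos (inv_pos.mpr hpos), inv_mul_cancel₀ hpos.ne'])
    rw [← appLin_apply, map_smul, norm_smul, norm_smul, mul_pow, mul_pow, appLin_apply,
      Real.norm_of_nonneg (inv_pos.mpr hpos).le, inv_pow] at h1
    have h2 : a * ((N ^ 2)⁻¹ * ‖x‖ ^ 2) + b * ((N ^ 2)⁻¹ * ‖app B x‖ ^ 2) =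
        (a * ‖x‖ ^ 2 + b * ‖app B x‖ ^ 2) / N ^ 2 := by ring
    rwa [h2, div_le_iff₀ (by positivity)] at h1

/-- Average the hypothesis over `τ` drawn from the signed weights of `x`, where `‖x‖₁ = 1`. The
off-diagonal terms reproduce the inequality for `x`; the diagonal ones cost at most `b`, and are
relatively `1/(d-1)`. -/
theorem lower_bound_of_signedBasis {m k d : ℕ} (hd : 2 ≤ d) {B : Matrix (Fin m) (Fin k) ℝ}
    {κ b : ℝ} (hκ : 0 ≤ κ)
    (hV : ∀ τ : Fin d → Fin k × Bool,
      κ * ‖∑ l, signedBasis (τ l)‖ ^ 2 ≤ ‖app B (∑ l, signedBasis (τ l))‖ ^ 2)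
    (hb : ∀ j, ∑ r, B r j ^ 2 ≤ b) (x : EuclideanSpace ℝ (Fin k)) :
    κ * ‖x‖ ^ 2 ≤ ‖app B x‖ ^ 2 + b * (∑ i, |x i|) ^ 2 / (d - 1) := by
  have hd' : (1 : ℝ) ≤ d - 1 := by
    have : (2 : ℝ) ≤ d := by exact_mod_cast hd
    linarith
  have main : ∀ x : EuclideanSpace ℝ (Fin k), ∑ i, |x i| = 1 →
      κ * ‖x‖ ^ 2 ≤ ‖app B x‖ ^ 2 + b / (d - 1) := by
    intro x hx
    have hp := (sum_signedWeight x).trans hx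
    have h1 := prodExp_signedBasis (d := d) LinearMap.id hx
    have h2 := prodExp_signedBasis (d := d) (appLin B) hx
    simp only [LinearMap.id_coe, id_eq, norm_signedBasis, one_pow, mul_one, hp, appLin_apply,
      norm_app_signedBasis_sq] at h1 h2
    have h3 : ∑ a, signedWeight x a * ∑ r, B r a.1 ^ 2 ≤ b := by
      calc _ ≤ ∑ a, signedWeight x a * b := Finset.sum_le_sum fun a _ =>
            mul_le_mul_of_nonneg_left (hb a.1) (signedWeight_nonneg x a)
        _ = b := by rw [← Finset.sum_mul, hp, one_mul]
    have h4 := prodExp_mono (signedWeight_nonneg x) hV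
    rw [prodExp_const_mul, h1, h2] at h4
    have hdpos : (0 : ℝ) < d := by linarith
    have h5 : d * ((d - 1) * (κ * ‖x‖ ^ 2)) ≤ d * (b + (d - 1) * ‖app B x‖ ^ 2) := by
      nlinarith [mul_le_mul_of_nonneg_left h3 hdpos.le, mul_nonneg hκ hdpos.le]
    have h6 := le_of_mul_le_mul_left h5 hdpos
    rw [← sub_le_iff_le_add', le_div_iff₀ (by linarith)]
    linarith
  have h := quadratic_le_of_sum_abs_eq_one (B := B) (a := κ) (b := -1) (c := b / (d - 1))
    (fun x hx => by linarith [main x hx]) x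
  rw [mul_div_right_comm]
  linarith

/-- The same averaging; here the diagonal term of `B` has a favourable sign and is dropped. -/
theorem upper_bound_of_signedBasis {m k d : ℕ} (hd : 2 ≤ d) {B : Matrix (Fin m) (Fin k) ℝ}
    {β : ℝ} (hV : ∀ τ : Fin d → Fin k × Bool,
      ‖app B (∑ l, signedBasis (τ l))‖ ^ 2 ≤ β * ‖∑ l, signedBasis (τ l)‖ ^ 2)
    (x : EuclideanSpace ℝ (Fin k)) :
    ‖app B x‖ ^ 2 ≤ β * (‖x‖ ^ 2 + (∑ i, |x i|) ^ 2 / (d - 1)) := by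
  have hd' : (1 : ℝ) ≤ d - 1 := by
    have : (2 : ℝ) ≤ d := by exact_mod_cast hd
    linarith
  have main : ∀ x : EuclideanSpace ℝ (Fin k), ∑ i, |x i| = 1 →
      ‖app B x‖ ^ 2 ≤ β * (‖x‖ ^ 2 + 1 / (d - 1)) := by
    intro x hx
    have hp := (sum_signedWeight x).trans hx
    have h1 := prodExp_signedBasis (d := d) LinearMap.id hx
    have h2 := prodExp_signedBasis (d := d) (appLin B) hx
    simp only [LinearMap.id_coe, id_eq, norm_signedBasis, one_pow, mul_one, hp, appLin_apply]
      at h1 h2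
    have h3 : 0 ≤ ∑ a, signedWeight x a * ‖app B (signedBasis a)‖ ^ 2 :=
      Finset.sum_nonneg fun a _ => mul_nonneg (signedWeight_nonneg x a) (sq_nonneg _)
    have h4 := prodExp_mono (signedWeight_nonneg x) hV
    rw [prodExp_const_mul, h1, h2] at h4
    have hdpos : (0 : ℝ) < d := by linarith
    have h5 : d * ((d - 1) * ‖app B x‖ ^ 2) ≤ d * (β * (1 + (d - 1) * ‖x‖ ^ 2)) := by
      nlinarith [mul_nonneg hdpos.le h3]
    have h6 := le_of_mul_le_mul_left h5 hdpos
    have h7 : β * (‖x‖ ^ 2 + 1 / (d - 1)) = β * (1 + (d - 1) * ‖x‖ ^ 2) / (d - 1) := by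
      field_simp
      ring
    rw [h7, le_div_iff₀ (by linarith)]
    linarith
  have h := quadratic_le_of_sum_abs_eq_one (B := B) (a := -β) (b := 1) (c := β / (d - 1))
    (fun x hx => by
      have := main x hx
      rw [mul_add, mul_one_div] at this
      linarith) x
  rw [mul_add, mul_div_assoc', mul_div_right_comm]
  linarith

/-! ### Best approximation by sparse vectors -/

instance {k s : ℕ} : Nonempty {T : Finset (Fin k) // T.card ≤ s} := ⟨⟨∅, by simp⟩⟩

theorem tailMass_le {k s : ℕ} (x : EuclideanSpace ℝ (Fin k)) {T : Finset (Fin k)}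
    (hT : T.card ≤ s) : tailMass s x ≤ ∑ i ∈ Tᶜ, |x i| :=
  ciInf_le (f := fun T : {T : Finset (Fin k) // T.card ≤ s} => ∑ i ∈ (T : Finset (Fin k))ᶜ, |x i|)
    (Set.finite_range _).bddBelow ⟨T, hT⟩

theorem exists_tailMass_eq {k : ℕ} (s : ℕ) (x : EuclideanSpace ℝ (Fin k)) :
    ∃ T : Finset (Fin k), T.card ≤ s ∧ tailMass s x = ∑ i ∈ Tᶜ, |x i| := by
  obtain ⟨⟨T, hT⟩, h⟩ := exists_eq_ciInf_of_finite
    (f := fun T : {T : Finset (Fin k) // T.card ≤ s} => ∑ i ∈ (T : Finset (Fin k))ᶜ, |x i|)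
  exact ⟨T, hT, h.symm⟩

theorem tailMass_nonneg {k : ℕ} (s : ℕ) (x : EuclideanSpace ℝ (Fin k)) : 0 ≤ tailMass s x := by
  obtain ⟨T, -, h⟩ := exists_tailMass_eq s x
  rw [h]
  exact Finset.sum_nonneg fun i _ => abs_nonneg _

theorem tailMass_le_sum {k : ℕ} (s : ℕ) (x : EuclideanSpace ℝ (Fin k)) :
    tailMass s x ≤ ∑ i, |x i| := by
  simpa using tailMass_le (s := s) x (T := ∅) (by simp)

theorem tailMass_eq_zero {k s : ℕ} {x : EuclideanSpace ℝ (Fin k)} (h : IsSparse s x) :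
    tailMass s x = 0 := by
  refine le_antisymm ((tailMass_le x h).trans (le_of_eq ?_)) (tailMass_nonneg s x)
  exact Finset.sum_eq_zero fun i hi => by simpa using hi

theorem tailMass_sub_le {k : ℕ} (s : ℕ) (x y : EuclideanSpace ℝ (Fin k)) :
    tailMass (2 * s) (x - y) ≤ tailMass s x + tailMass s y := by
  obtain ⟨T, hT, hx⟩ := exists_tailMass_eq s x
  obtain ⟨U, hU, hy⟩ := exists_tailMass_eq s y
  rw [hx, hy]
  calc _ ≤ ∑ i ∈ (T ∪ U)ᶜ, |(x - y) i| :=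
        tailMass_le _ ((Finset.card_union_le T U).trans (by omega))
    _ ≤ ∑ i ∈ (T ∪ U)ᶜ, (|x i| + |y i|) := Finset.sum_le_sum fun i _ => abs_sub _ _
    _ ≤ _ := by
        rw [Finset.sum_add_distrib]
        exact add_le_add
          (Finset.sum_le_sum_of_subset_of_nonneg
            (Finset.compl_subset_compl.mpr Finset.subset_union_left) fun _ _ _ => abs_nonneg _)
          (Finset.sum_le_sum_of_subset_of_nonneg
            (Finset.compl_subset_compl.mpr Finset.subset_union_right) fun _ _ _ => abs_nonneg _)

theorem tailMass_le_mul {k : ℕ} (s : ℕ) {x y : EuclideanSpace ℝ (Fin k)} {c : ℝ}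
    (h : ∀ i, |y i| ≤ c * |x i|) : tailMass s y ≤ c * tailMass s x := by
  obtain ⟨T, hT, hx⟩ := exists_tailMass_eq s x
  rw [hx, Finset.mul_sum]
  exact (tailMass_le y hT).trans (Finset.sum_le_sum fun i _ => h i)

/-- The `s` largest entries of `x` dominate the other ones. -/
theorem exists_top_entries {k : ℕ} (s : ℕ) (x : EuclideanSpace ℝ (Fin k)) :
    ∃ T : Finset (Fin k), T.card ≤ s ∧ tailMass s x = ∑ i ∈ Tᶜ, |x i| ∧
      ∀ j ∉ T, s * x j ^ 2 ≤ ∑ i ∈ T, x i ^ 2 := by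
  obtain ⟨T, hT, hx⟩ := exists_tailMass_eq s x
  refine ⟨T, hT, hx, fun j hj => ?_⟩
  have hcompl : ∀ U : Finset (Fin k), ∑ i ∈ Uᶜ, |x i| = ∑ i, |x i| - ∑ i ∈ U, |x i| :=
    fun U => by rw [← Finset.sum_compl_add_sum U]; ring
  have hmin : ∀ U : Finset (Fin k), U.card ≤ s → ∑ i ∈ U, |x i| ≤ ∑ i ∈ T, |x i| := by
    intro U hU
    have := tailMass_le x hU
    rw [hx, hcompl, hcompl] at this
    linarith
  -- Exchange argument. If `T` has room, then adding `j` cannot gain mass, so `x j = 0`; if it is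
  -- full, then swapping `j` for any `i ∈ T` cannot gain.
  rcases hT.lt_or_eq with hlt | heq
  · have := hmin (insert j T) (by rw [Finset.card_insert_of_notMem hj]; omega)
    rw [Finset.sum_insert hj] at this
    have h0 : x j = 0 := abs_eq_zero.mp (le_antisymm (by linarith) (abs_nonneg _))
    rw [h0]
    simpa using Finset.sum_nonneg fun i _ => sq_nonneg (x i)
  · have hle : ∀ i ∈ T, x j ^ 2 ≤ x i ^ 2 := by
      intro i hi
      have hj' : j ∉ T.erase i := fun h => hj (Finset.mem_of_mem_erase h)
      have := hmin (insert j (T.erase i)) (by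
        rw [Finset.card_insert_of_notMem hj', Finset.card_erase_of_mem hi]
        have := Finset.card_pos.mpr ⟨i, hi⟩
        omega)
      rw [Finset.sum_insert hj', ← Finset.add_sum_erase T _ hi] at this
      exact sq_le_sq.mpr (by linarith)
    rw [← heq, ← nsmul_eq_mul]
    exact Finset.card_nsmul_le_sum T _ _ hle

/-- The part of `x` supported on `T`. -/
def restrictTo {k : ℕ} (T : Finset (Fin k)) (x : EuclideanSpace ℝ (Fin k)) :
    EuclideanSpace ℝ (Fin k) :=
  WithLp.toLp 2 fun i => if i ∈ T then x i else 0

theorem norm_restrictTo_sq {k : ℕ} (T : Finset (Fin k)) (x : EuclideanSpace ℝ (Fin k)) :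
    ‖restrictTo T x‖ ^ 2 = ∑ i ∈ T, x i ^ 2 := by
  simp [EuclideanSpace.real_norm_sq_eq, restrictTo, ite_pow]

theorem sum_abs_restrictTo {k : ℕ} (T : Finset (Fin k)) (x : EuclideanSpace ℝ (Fin k)) :
    ∑ i, |restrictTo T x i| = ∑ i ∈ T, |x i| := by
  simp [restrictTo, apply_ite abs]

theorem restrictTo_add_compl {k : ℕ} (T : Finset (Fin k)) (x : EuclideanSpace ℝ (Fin k)) :
    restrictTo T x + restrictTo Tᶜ x = x := by
  ext i
  by_cases h : i ∈ T <;> simp [restrictTo, h]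

theorem isSparse_restrictTo {k s : ℕ} {T : Finset (Fin k)} (hT : T.card ≤ s)
    (x : EuclideanSpace ℝ (Fin k)) : IsSparse s (restrictTo T x) := by
  refine (Finset.card_le_card fun i hi => ?_).trans hT
  by_contra h
  simp [restrictTo, h] at hi

theorem sum_abs_le_sqrt_mul_norm {k s : ℕ} {T : Finset (Fin k)} (hT : T.card ≤ s)
    (x : EuclideanSpace ℝ (Fin k)) : ∑ i ∈ T, |x i| ≤ √(s : ℝ) * ‖x‖ := by
  refine le_of_sq_le_sq ?_ (by positivity)
  rw [mul_pow, Real.sq_sqrt (by positivity), EuclideanSpace.real_norm_sq_eq]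
  calc (∑ i ∈ T, |x i|) ^ 2 ≤ T.card * ∑ i ∈ T, |x i| ^ 2 := sq_sum_le_card_mul_sum_sq
    _ ≤ s * ∑ i, x i ^ 2 := by
        simp only [sq_abs]
        gcongr
        exact Finset.subset_univ T

/-! ### The robust null space property -/

/-- A quantitative null space property, which makes recovery at sparsity `t` stable. -/
def NullSpaceProp {m k : ℕ} (t : ℕ) (B : Matrix (Fin m) (Fin k) ℝ) : Prop :=
  ∀ h : EuclideanSpace ℝ (Fin k), ‖h‖ ≤ 60 * (tailMass (2 * t) h / √(t : ℝ) + ‖app B h‖)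

/-- By Cauchy–Schwarz on the best `2t` entries, `‖h‖₁² ≤ 4t ‖h‖² + 2g²`. Dividing by `16t` leaves
`‖h‖²/4`, which the left side absorbs. -/
theorem nullSpaceProp_of_lower_bound {m k t : ℕ} (ht : 1 ≤ t) {B : Matrix (Fin m) (Fin k) ℝ}
    (hB : ∀ x : EuclideanSpace ℝ (Fin k),
      1 / 2 * ‖x‖ ^ 2 ≤ ‖app B x‖ ^ 2 + (∑ i, |x i|) ^ 2 / (16 * t)) :
    NullSpaceProp t B := by
  intro h
  obtain ⟨T, hT, htail⟩ := exists_tailMass_eq (2 * t) h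
  set g := tailMass (2 * t) h with hg
  have hg0 : 0 ≤ g := tailMass_nonneg _ _
  have htpos : (0 : ℝ) < t := by exact_mod_cast ht
  have hsum : ∑ i, |h i| ≤ √((2 * t : ℕ) : ℝ) * ‖h‖ + g := by
    rw [htail, ← Finset.sum_add_sum_compl T]
    gcongr
    exact sum_abs_le_sqrt_mul_norm hT h
  have hsq : (∑ i, |h i|) ^ 2 ≤ 4 * t * ‖h‖ ^ 2 + 2 * g ^ 2 := by
    have h1 := pow_le_pow_left₀ (Finset.sum_nonneg fun i _ => abs_nonneg _) hsum 2
    have h2 : √((2 * t : ℕ) : ℝ) ^ 2 = 2 * t := by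
      rw [Real.sq_sqrt (by positivity)]; push_cast; ring
    nlinarith [sq_nonneg (√((2 * t : ℕ) : ℝ) * ‖h‖ - g)]
  have h1 := hB h
  have h2 : (∑ i, |h i|) ^ 2 / (16 * t) ≤ 1 / 4 * ‖h‖ ^ 2 + (g / √(t : ℝ)) ^ 2 / 8 := by
    rw [div_pow, Real.sq_sqrt htpos.le, div_le_iff₀ (by positivity)]
    refine hsq.trans (le_of_eq ?_)
    field_simp
    ring
  refine le_of_sq_le_sq ?_ (by positivity)
  have h3 : 0 ≤ g / √(t : ℝ) := by positivity
  nlinarith [mul_nonneg h3 (norm_nonneg (app B h)), sq_nonneg (g / √(t : ℝ)),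
    sq_nonneg ‖app B h‖]

/-- Split `h` into its top `2s` entries `a` and the rest `c`. RIP bounds `‖B a‖` below. Maurey's
method with `d = 2s` bounds `‖B c‖` above although `c` is not sparse, and `c` is small because its
entries are dominated by those of `a`. -/
theorem nullSpaceProp_of_RIP {m k s : ℕ} (hs : 1 ≤ s) {B : Matrix (Fin m) (Fin k) ℝ}
    (hB : RIP (2 * s) (1 / √2) B) : NullSpaceProp s B := by
  have hθ : (1 : ℝ) / √2 < 71 / 100 := by
    rw [div_lt_iff₀ (by positivity)]
    have : (141 / 100 : ℝ) < √2 := Real.lt_sqrt_of_sq_lt (by norm_num)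
    linarith
  intro h
  obtain ⟨T, hT, htail, htop⟩ := exists_top_entries (2 * s) h
  set g := tailMass (2 * s) h with hg
  have hg0 : 0 ≤ g := tailMass_nonneg _ _
  have hspos : (0 : ℝ) < s := by exact_mod_cast hs
  have hs1 : (1 : ℝ) ≤ s := by exact_mod_cast hs
  set G := g / √(s : ℝ) with hG
  have hG0 : 0 ≤ G := by positivity
  have hGsq : G ^ 2 = g ^ 2 / s := by rw [hG, div_pow, Real.sq_sqrt hspos.le]
  set a := restrictTo T h with ha
  set c := restrictTo Tᶜ h with hc
  have hac : h = a + c := (restrictTo_add_compl T h).symm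
  have hcc : ‖c‖ ^ 2 ≤ ‖a‖ * G := by
    have hent : ∀ j ∈ Tᶜ, |h j| ≤ ‖a‖ / √(s : ℝ) := by
      intro j hj
      have h1 := htop j (Finset.mem_compl.mp hj)
      rw [← norm_restrictTo_sq] at h1
      rw [le_div_iff₀ (by positivity)]
      refine le_of_sq_le_sq ?_ (norm_nonneg _)
      rw [mul_pow, sq_abs, Real.sq_sqrt hspos.le]
      push_cast at h1
      nlinarith [mul_nonneg hspos.le (sq_nonneg (h j))]
    rw [norm_restrictTo_sq]
    calc ∑ i ∈ Tᶜ, h i ^ 2 = ∑ i ∈ Tᶜ, |h i| * |h i| :=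
          Finset.sum_congr rfl fun i _ => by rw [← sq, sq_abs]
      _ ≤ ∑ i ∈ Tᶜ, ‖a‖ / √(s : ℝ) * |h i| := Finset.sum_le_sum fun i hi =>
          mul_le_mul_of_nonneg_right (hent i hi) (abs_nonneg _)
      _ = ‖a‖ * G := by rw [← Finset.mul_sum, ← htail, hG]; ring
  have hup : ‖app B c‖ ^ 2 ≤ (171 / 100) ^ 2 * (‖a‖ * G + G ^ 2) := by
    have h1 := upper_bound_of_signedBasis (d := 2 * s) (by omega) (B := B)
      (β := (171 / 100 : ℝ) ^ 2) (fun τ => by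
        have h2 := (hB _ (isSparse_sum_signedBasis τ)).2
        rw [← mul_pow]
        refine pow_le_pow_left₀ (norm_nonneg _) (h2.trans ?_) 2
        exact mul_le_mul_of_nonneg_right (by linarith) (norm_nonneg _)) c
    refine h1.trans ?_
    rw [hc, sum_abs_restrictTo, ← htail, ← hc, hGsq]
    gcongr
    push_cast
    linarith
  have hlow : 29 / 100 * ‖a‖ ≤ ‖app B a‖ :=
    (mul_le_mul_of_nonneg_right (by linarith) (norm_nonneg _)).trans
      (hB a (isSparse_restrictTo hT h)).1
  have htri : ‖app B a‖ ≤ ‖app B h‖ + ‖app B c‖ := by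
    have : app B a = app B h - app B c := by rw [← app_sub, hac, add_sub_cancel_right]
    rw [this]
    exact norm_sub_le _ _
  -- Weighted AM–GM on `G (‖a‖ + G)`. The weight `1/12` makes the coefficient of `‖a‖` equal to
  -- `0.1425`, below the `0.29` available in `hlow`.
  have hBc : ‖app B c‖ ≤ 171 / 100 * (3 * G + (‖a‖ + G) / 12) := by
    refine le_of_sq_le_sq (hup.trans ?_) (by positivity)
    rw [mul_pow]
    gcongr
    nlinarith [sq_nonneg (3 * G - (‖a‖ + G) / 12)]
  have hcn : ‖c‖ ≤ (‖a‖ + G) / 2 := by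
    refine le_of_sq_le_sq (hcc.trans ?_) (by positivity)
    nlinarith [sq_nonneg (‖a‖ - G)]
  have hn : ‖h‖ ≤ ‖a‖ + ‖c‖ := by
    conv_lhs => rw [hac]
    exact norm_add_le _ _
  linarith [norm_nonneg (app B h)]

/-! ### The recovery procedure -/

/-- The decoder nearly minimizes `F x = tailMass t x / √t + ‖B x - y‖`. The null space property
gives `‖x - z‖ ≤ 60 (F x + F z)`, so a minimizing sequence is bounded. A limit point serves: the
inequality passes to the limit with `F z` replaced by the infimum, without continuity of `F`. -/
theorem exists_decoder {m k t : ℕ} {B : Matrix (Fin m) (Fin k) ℝ} (hB : NullSpaceProp t B)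
    (y : EuclideanSpace ℝ (Fin m)) :
    ∃ z : EuclideanSpace ℝ (Fin k), ∀ x : EuclideanSpace ℝ (Fin k),
      ‖x - z‖ ≤ 120 * (tailMass t x / √(t : ℝ) + ‖app B x - y‖) := by
  set F : EuclideanSpace ℝ (Fin k) → ℝ := fun x => tailMass t x / √(t : ℝ) + ‖app B x - y‖ with hF
  have hF0 : ∀ x, 0 ≤ F x := fun x =>
    add_nonneg (div_nonneg (tailMass_nonneg _ _) (Real.sqrt_nonneg _)) (norm_nonneg _)
  have hbdd : BddBelow (Set.range F) := ⟨0, by rintro _ ⟨x, rfl⟩; exact hF0 x⟩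
  have hdist : ∀ x z, ‖x - z‖ ≤ 60 * (F x + F z) := by
    intro x z
    refine (hB (x - z)).trans ?_
    have h1 : tailMass (2 * t) (x - z) / √(t : ℝ) ≤
        tailMass t x / √(t : ℝ) + tailMass t z / √(t : ℝ) := by
      rw [← add_div]
      gcongr
      exact tailMass_sub_le t x z
    have h2 : ‖app B (x - z)‖ ≤ ‖app B x - y‖ + ‖app B z - y‖ := by
      have : app B (x - z) = (app B x - y) - (app B z - y) := by rw [app_sub]; abel
      rw [this]
      exact norm_sub_le _ _
    simp only [hF]
    linarith
  set I := ⨅ x, F x with hI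
  have hseq : ∀ n : ℕ, ∃ z, F z < I + 1 / ((n : ℝ) + 1) := fun n =>
    exists_lt_of_ciInf_lt (lt_add_of_pos_right _ (by positivity))
  choose z hz using hseq
  have hz1 : ∀ n, F (z n) ≤ I + 1 := fun n => (hz n).le.trans (by
    have : 1 / ((n : ℝ) + 1) ≤ 1 := by
      rw [div_le_one (by positivity)]
      linarith [n.cast_nonneg (α := ℝ)]
    linarith)
  obtain ⟨w, -, φ, hφ, hlim⟩ := tendsto_subseq_of_bounded
    (Metric.isBounded_closedBall (x := z 0) (r := 60 * (2 * (I + 1)))) (x := z) (fun n => by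
      rw [mem_closedBall_iff_norm]
      exact (hdist _ _).trans (by linarith [hz1 n, hz1 0]))
  refine ⟨w, fun x => ?_⟩
  have hl : Filter.Tendsto (fun n => ‖x - z (φ n)‖) Filter.atTop (nhds ‖x - w‖) :=
    (tendsto_const_nhds.sub hlim).norm
  have hr : Filter.Tendsto (fun n => 60 * (F x + (I + 1 / ((φ n : ℝ) + 1)))) Filter.atTop
      (nhds (60 * (F x + (I + 0)))) :=
    ((((tendsto_one_div_add_atTop_nhds_zero_nat (𝕜 := ℝ)).comp hφ.tendsto_atTop).const_add
      I).const_add (F x)).const_mul 60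
  have hle := le_of_tendsto_of_tendsto' hl hr fun n =>
    (hdist x (z (φ n))).trans (by linarith [(hz (φ n)).le])
  have : I ≤ F x := ciInf_le hbdd x
  calc _ ≤ _ := hle
    _ ≤ 120 * F x := by linarith

/-- The largest sparsity `t ≤ s` at which `B` has the null space property. -/
def recoveryLevel {m k : ℕ} (B : Matrix (Fin m) (Fin k) ℝ) (s : ℕ) : ℕ :=
  sSup {t | t ≤ s ∧ NullSpaceProp t B}

/-- Recovery at the largest sparsity, up to the target, that the measurement matrix supports. -/
def adaptiveRecovery : Recovery := fun _ _ B y s =>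
  Classical.epsilon fun z => ∀ x,
    ‖x - z‖ ≤ 120 * (tailMass (recoveryLevel B s) x / √(recoveryLevel B s : ℝ) + ‖app B x - y‖)

/-- The level used depends on `B` and is only known to lie between `t₀` and `s`. The set of
admissible levels is nonempty and bounded, so its supremum is attained. -/
theorem adaptiveRecovery_spec {m k s t₀ : ℕ} {B : Matrix (Fin m) (Fin k) ℝ} (hts : t₀ ≤ s)
    (hB : NullSpaceProp t₀ B) (y : EuclideanSpace ℝ (Fin m)) :
    ∃ t, t₀ ≤ t ∧ t ≤ s ∧ ∀ x, ‖x - adaptiveRecovery m k B y s‖ ≤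
      120 * (tailMass t x / √(t : ℝ) + ‖app B x - y‖) := by
  have hne : {t | t ≤ s ∧ NullSpaceProp t B}.Nonempty := ⟨t₀, hts, hB⟩
  have hbdd : BddAbove {t | t ≤ s ∧ NullSpaceProp t B} := ⟨s, fun t ht => ht.1⟩
  have hmem := Nat.sSup_mem hne hbdd
  exact ⟨recoveryLevel B s, le_csSup hbdd ⟨hts, hB⟩, hmem.1,
    Classical.epsilon_spec (exists_decoder hmem.2 y)⟩

theorem adaptiveRecovery_isStable : adaptiveRecovery.IsStable 120 120 := by
  intro m k s hs B hB x e
  obtain ⟨t, h1, h2, h⟩ := adaptiveRecovery_spec le_rfl (nullSpaceProp_of_RIP hs hB) (app B x + e)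
  obtain rfl : t = s := le_antisymm h2 h1
  refine (h x).trans (le_of_eq ?_)
  rw [show app B x - (app B x + e) = -e by abel, norm_neg]
  ring

/-! ### The mechanism of a matrix with balanced columns -/

/-- `A` is a sign matrix whose columns have `m e^{-ε}` entries `+1`, up to a relative error `ρ`. -/
def Balanced {m k : ℕ} (ε ρ : ℝ) (A : Matrix (Fin m) (Fin k) ℝ) : Prop :=
  (∀ r x, A r x = 1 ∨ A r x = -1) ∧
    ∀ x, |(colCount A x : ℝ) - m * Real.exp (-ε)| ≤ ρ * (m * Real.exp (-ε))

section Channel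

variable {m k : ℕ} {ε ρ : ℝ} {A : Matrix (Fin m) (Fin k) ℝ}

/-- The main term is the numerator of `rescale`, so `D'` measures only the fluctuation of the column
count. -/
theorem colWeight_eq (x : Fin k) : colWeight ε A x = m * (2 - Real.exp (-ε)) +
    (colCount A x - m * Real.exp (-ε)) * (Real.exp ε - 1) := by
  have h : Real.exp (-ε) * Real.exp ε = 1 := by rw [← Real.exp_add]; simp
  unfold colWeight
  linear_combination (m : ℝ) * h

theorem colWeight_pos (hm : 1 ≤ m) (hε : 0 ≤ ε) (x : Fin k) : 0 < colWeight ε A x := by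
  have h1 := Real.one_le_exp hε
  have hm' : (1 : ℝ) ≤ m := by exact_mod_cast hm
  have : colWeight ε A x = colCount A x * (Real.exp ε - 1) + m := by unfold colWeight; ring
  rw [this]
  have := mul_nonneg (colCount A x).cast_nonneg (sub_nonneg.mpr h1)
  linarith

theorem two_sub_exp_neg_pos (hε : 0 ≤ ε) : 0 < 2 - Real.exp (-ε) := by
  have : Real.exp (-ε) ≤ 1 := Real.exp_le_one_iff.mpr (by linarith)
  linarith

theorem Balanced.abs_colWeight_sub_le (hA : Balanced ε ρ A) (hε : 0 ≤ ε) (hρ : 0 ≤ ρ)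
    (x : Fin k) : |colWeight ε A x - m * (2 - Real.exp (-ε))| ≤
      ρ / 2 * (m * (2 - Real.exp (-ε))) := by
  have h1 := Real.one_le_exp hε
  have h : Real.exp (-ε) * Real.exp ε = 1 := by rw [← Real.exp_add]; simp
  rw [colWeight_eq, add_sub_cancel_left, abs_mul, abs_of_nonneg (sub_nonneg.mpr h1)]
  refine (mul_le_mul_of_nonneg_right (hA.2 x) (sub_nonneg.mpr h1)).trans ?_
  have h2 : ρ * (m * Real.exp (-ε)) * (Real.exp ε - 1) = ρ * m * (1 - Real.exp (-ε)) := by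
    linear_combination ρ * m * h
  rw [h2]
  have h3 : 0 ≤ ρ * m * Real.exp (-ε) := by positivity
  nlinarith

theorem sum_channel (hm : 1 ≤ m) (hε : 0 ≤ ε) (x : Fin k) : ∑ y, channel ε A x y = 1 := by
  classical
  have hw := colWeight_pos (A := A) hm hε x
  have h1 : ∀ y, channel ε A x y = (1 + if A y x = 1 then Real.exp ε - 1 else 0) /
      colWeight ε A x := by
    intro y
    unfold channel
    split_ifs <;> ring
  simp only [h1]
  have hcard : ∑ y, (if A y x = 1 then Real.exp ε - 1 else 0) =
      colCount A x * (Real.exp ε - 1) := by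
    rw [← Finset.sum_filter, Finset.sum_const, nsmul_eq_mul]
    unfold colCount
    congr!
  rw [← Finset.sum_div, Finset.sum_add_distrib, hcard, div_eq_one_iff_eq hw.ne']
  simp only [Finset.sum_const, Finset.card_univ, Fintype.card_fin, nsmul_eq_mul, mul_one]
  unfold colWeight
  ring

theorem channel_nonneg (hm : 1 ≤ m) (hε : 0 ≤ ε) (x : Fin k) (y : Fin m) :
    0 ≤ channel ε A x y := by
  have hw := colWeight_pos (A := A) hm hε x
  unfold channel
  split_ifs <;> positivity

theorem isLDP_of_colWeight_le {η : ℝ} (hm : 1 ≤ m) (hε : 0 ≤ ε)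
    (h : ∀ x x', colWeight ε A x' ≤ Real.exp η * colWeight ε A x) :
    IsLDP (channel ε A) (ε + η) := by
  refine ⟨channel_nonneg hm hε, sum_channel hm hε, fun x x' y => ?_⟩
  have hw := colWeight_pos (A := A) hm hε x
  have hw' := colWeight_pos (A := A) hm hε x'
  have h1 := Real.one_le_exp hε
  have hup : channel ε A x y ≤ Real.exp ε / colWeight ε A x := by
    unfold channel
    split_ifs
    · exact le_rfl
    · gcongr
  have hlow : 1 / colWeight ε A x' ≤ channel ε A x' y := by
    unfold channel
    split_ifs
    · gcongr
    · exact le_rfl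
  calc channel ε A x y ≤ Real.exp ε / colWeight ε A x := hup
    _ ≤ Real.exp (ε + η) * (1 / colWeight ε A x') := by
        rw [Real.exp_add, mul_one_div, div_le_div_iff₀ hw hw']
        nlinarith [mul_le_mul_of_nonneg_left (h x x') (Real.exp_pos ε).le]
    _ ≤ _ := by gcongr

/-- Beyond the factor `e^ε`, privacy loses only the ratio of two column weights, at most `(1 +
ρ/2)/(1 - ρ/2) ≤ 1 + 2ρ ≤ e^η`. -/
theorem Balanced.isLDP {η : ℝ} (hA : Balanced ε ρ A) (hm : 1 ≤ m) (hε : 0 ≤ ε) (hρ : 0 ≤ ρ)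
    (hρ1 : ρ ≤ 1) (hρη : 2 * ρ ≤ η) : IsLDP (channel ε A) (ε + η) := by
  refine isLDP_of_colWeight_le hm hε fun x x' => ?_
  have hc : 0 < m * (2 - Real.exp (-ε)) :=
    mul_pos (by exact_mod_cast hm) (two_sub_exp_neg_pos hε)
  have h1 := (abs_le.mp (hA.abs_colWeight_sub_le hε hρ x)).1
  have h2 := (abs_le.mp (hA.abs_colWeight_sub_le hε hρ x')).2
  set W := m * (2 - Real.exp (-ε)) with hW
  have h3 : 1 + 2 * ρ ≤ Real.exp η := by
    have := Real.add_one_le_exp η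
    linarith
  have h4 : 0 ≤ (1 - ρ / 2) * W := mul_nonneg (by linarith) hc.le
  calc colWeight ε A x' ≤ (1 + ρ / 2) * W := by linarith
    _ ≤ (1 + 2 * ρ) * ((1 - ρ / 2) * W) := by
        have : 0 ≤ ρ * (1 - ρ) * W := mul_nonneg (mul_nonneg hρ (by linarith)) hc.le
        nlinarith
    _ ≤ Real.exp η * ((1 - ρ / 2) * W) := mul_le_mul_of_nonneg_right h3 h4
    _ ≤ Real.exp η * colWeight ε A x := by
        gcongr
        linarith

theorem rescale_pos (hm : 1 ≤ m) (hε : 0 ≤ ε) (x : Fin k) : 0 < rescale ε A x :=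
  div_pos (mul_pos (by exact_mod_cast hm) (two_sub_exp_neg_pos hε)) (colWeight_pos hm hε x)

theorem Balanced.rescale_bounds (hA : Balanced ε ρ A) (hm : 1 ≤ m) (hε : 0 ≤ ε) (hρ : 0 ≤ ρ)
    (hρ1 : ρ ≤ 1) (x : Fin k) :
    |rescale ε A x - 1| ≤ ρ ∧ rescale ε A x ≤ 2 ∧ (rescale ε A x)⁻¹ ≤ 2 := by
  have hc : 0 < m * (2 - Real.exp (-ε)) :=
    mul_pos (by exact_mod_cast hm) (two_sub_exp_neg_pos hε)
  have hw := colWeight_pos (A := A) hm hε x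
  obtain ⟨h1, h2⟩ := abs_le.mp (hA.abs_colWeight_sub_le hε hρ x)
  unfold rescale
  set W := m * (2 - Real.exp (-ε)) with hW
  set w := colWeight ε A x
  have h3 : 0 ≤ ρ * (1 - ρ) * W := mul_nonneg (mul_nonneg hρ (by linarith)) hc.le
  have h4 : 0 ≤ (1 - ρ) * W := mul_nonneg (by linarith) hc.le
  refine ⟨?_, ?_, ?_⟩
  · rw [abs_le, div_sub_one hw.ne', le_div_iff₀ hw, div_le_iff₀ hw]
    constructor <;> nlinarith [mul_le_mul_of_nonneg_left h1 hρ, mul_le_mul_of_nonneg_left h2 hρ,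
      mul_nonneg hρ hw.le]
  · rw [div_le_iff₀ hw]
    nlinarith
  · rw [inv_div, div_le_iff₀ hc]
    nlinarith

/-! ### The linear model of the measurement -/

/-- The factor in front of the measurement. -/
def gain (ε : ℝ) : ℝ := (2 * Real.exp ε - 1) / (Real.exp ε - 1) ^ (3 / 2 : ℝ)

theorem rpow_three_halves {u : ℝ} (hu : 0 < u) : u ^ (3 / 2 : ℝ) = u * √u := by
  rw [show (3 / 2 : ℝ) = 1 + 1 / 2 by norm_num, Real.rpow_add hu, Real.rpow_one,
    Real.sqrt_eq_rpow]

theorem signStd_eq (hε : 0 < ε) : signStd ε = 2 * Real.exp (-ε) * √(Real.exp ε - 1) := by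
  have h : Real.exp (-ε) * Real.exp ε = 1 := by rw [← Real.exp_add]; simp
  have h1 : 0 < Real.exp ε - 1 := by linarith [Real.add_one_le_exp ε]
  have h2 : 1 - signMean ε ^ 2 = (2 * Real.exp (-ε)) ^ 2 * (Real.exp ε - 1) := by
    unfold signMean
    linear_combination (-4 * Real.exp (-ε)) * h
  rw [signStd, h2, Real.sqrt_mul (sq_nonneg _), Real.sqrt_sq (by positivity)]

/-- The identity that dictates the factor in front of the measurement. -/
theorem gain_mul_signStd (hε : 0 < ε) :
    gain ε * ((Real.exp ε - 1) * signStd ε) = 2 * (2 - Real.exp (-ε)) := by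
  have h : Real.exp (-ε) * Real.exp ε = 1 := by rw [← Real.exp_add]; simp
  have h1 : 0 < Real.exp ε - 1 := by linarith [Real.add_one_le_exp ε]
  have h2 : 0 < √(Real.exp ε - 1) := Real.sqrt_pos.mpr h1
  unfold gain
  rw [signStd_eq hε, rpow_three_halves h1]
  field_simp
  linear_combination 2 * h

theorem gain_nonneg (hε : 0 < ε) : 0 ≤ gain ε := by
  have h1 : 0 < Real.exp ε - 1 := by linarith [Real.add_one_le_exp ε]
  exact div_nonneg (by linarith) (Real.rpow_nonneg h1.le _)

/-- The gain decays like `2 e^{-ε/2}`, which is the source of `e^ε` in the sample size. It blows up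
at `ε = 0`; here `e^ε - 1 ≥ 1/2 + 1/8`. -/
theorem gain_le (hε : 1 / 2 ≤ ε) : gain ε ≤ 9 * √(Real.exp (-ε)) := by
  have hq := Real.quadratic_le_exp_of_nonneg (show (0 : ℝ) ≤ ε by linarith)
  have hu : 5 / 8 ≤ Real.exp ε - 1 := by nlinarith
  set u := Real.exp ε - 1 with hudef
  have hu0 : 0 < u := by linarith
  have hE : Real.exp ε = u + 1 := by rw [hudef]; ring
  refine le_of_sq_le_sq ?_ (by positivity)
  rw [mul_pow, Real.sq_sqrt (Real.exp_pos _).le, Real.exp_neg]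
  unfold gain
  rw [← hudef, rpow_three_halves hu0, div_pow, mul_pow, Real.sq_sqrt hu0.le, hE,
    ← div_eq_mul_inv, div_le_div_iff₀ (by positivity) (by positivity)]
  have h2 : 0 ≤ u ^ 2 * (u - 5 / 8) := mul_nonneg (sq_nonneg _) (by linarith)
  have h3 : 0 ≤ u * (u - 5 / 8) := mul_nonneg hu0.le (by linarith)
  nlinarith

/-- The law of a privatized sample. -/
def outDist (ε : ℝ) (A : Matrix (Fin m) (Fin k) ℝ) (p : EuclideanSpace ℝ (Fin k)) :
    EuclideanSpace ℝ (Fin m) :=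
  WithLp.toLp 2 fun y => ∑ x, p x * channel ε A x y

/-- The vector `D' p`. -/
def rescaled (ε : ℝ) (A : Matrix (Fin m) (Fin k) ℝ) (p : EuclideanSpace ℝ (Fin k)) :
    EuclideanSpace ℝ (Fin k) :=
  WithLp.toLp 2 fun x => rescale ε A x * p x

/-- For a sign matrix each channel entry is affine in `A y x`. Subtracting `D'/√m`, rather than
`1/√m`, centres it exactly at `signMean ε`. -/
theorem gain_mul_channel (hm : 1 ≤ m) (hε : 0 < ε) {x : Fin k} {y : Fin m}
    (hA : A y x = 1 ∨ A y x = -1) :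
    gain ε * (√(m : ℝ) * channel ε A x y - rescale ε A x / √(m : ℝ)) =
      sensing ε A y x * rescale ε A x := by
  have hmpos : (0 : ℝ) < m := by exact_mod_cast hm
  have hsm : 0 < √(m : ℝ) := Real.sqrt_pos.mpr hmpos
  have hw := colWeight_pos (A := A) hm hε.le x
  have h : Real.exp (-ε) * Real.exp ε = 1 := by rw [← Real.exp_add]; simp
  have h1 : 0 < Real.exp ε - 1 := by linarith [Real.add_one_le_exp ε]
  have hσ : 0 < signStd ε := by
    rw [signStd_eq hε]
    have := Real.sqrt_pos.mpr h1
    positivity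
  have hch : channel ε A x y = (1 + (Real.exp ε - 1) * ((A y x + 1) / 2)) / colWeight ε A x := by
    unfold channel
    rcases hA with h | h <;> rw [h] <;> norm_num
  have hg := gain_mul_signStd hε
  have hms : √(m : ℝ) ^ 2 = m := Real.sq_sqrt hmpos.le
  have hsplit : √(m : ℝ) * channel ε A x y - rescale ε A x / √(m : ℝ) =
      √(m : ℝ) / colWeight ε A x * ((Real.exp ε - 1) * (A y x - signMean ε) / 2) := by
    rw [hch]
    unfold rescale signMean
    field_simp
    rw [hms]
    linear_combination 2 * (m : ℝ) * h
  rw [hsplit]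
  unfold sensing rescale
  field_simp
  rw [hms]
  linear_combination (m : ℝ) * (A y x - signMean ε) * hg

/-- The first term is sampling noise. The second appears because the method subtracts `1/√m`,
whereas exact centring requires `(∑ D' p)/√m`. -/
theorem measurement_sub_app (hm : 1 ≤ m) (hε : 0 < ε) (hA : ∀ r x, A r x = 1 ∨ A r x = -1)
    (p : EuclideanSpace ℝ (Fin k)) (q : EuclideanSpace ℝ (Fin m)) :
    measurement ε q - app (sensing ε A) (rescaled ε A p) =
      (gain ε * √(m : ℝ)) • (q - outDist ε A p) +
        (gain ε * (∑ x, rescale ε A x * p x - 1)) • WithLp.toLp 2 fun _ => 1 / √(m : ℝ) := by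
  ext y
  have h : ∑ x, sensing ε A y x * (rescale ε A x * p x) =
      gain ε * (√(m : ℝ) * ∑ x, p x * channel ε A x y -
        (∑ x, rescale ε A x * p x) / √(m : ℝ)) := by
    rw [Finset.mul_sum, Finset.sum_div, ← Finset.sum_sub_distrib, Finset.mul_sum]
    refine Finset.sum_congr rfl fun x _ => ?_
    rw [← mul_assoc, ← gain_mul_channel hm hε (hA y x)]
    ring
  simp only [PiLp.sub_apply, PiLp.add_apply, PiLp.smul_apply, smul_eq_mul, measurement, app,
    rescaled, outDist]
  rw [h]
  change gain ε * _ - _ = _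
  ring

theorem norm_const_inv_sqrt (hm : 1 ≤ m) :
    ‖(WithLp.toLp 2 fun _ => 1 / √(m : ℝ) : EuclideanSpace ℝ (Fin m))‖ = 1 := by
  have hmpos : (0 : ℝ) < m := by exact_mod_cast hm
  rw [← sq_eq_sq₀ (norm_nonneg _) zero_le_one, EuclideanSpace.real_norm_sq_eq]
  simp [Real.sq_sqrt hmpos.le, hmpos.ne']

theorem Balanced.abs_sum_rescale_sub_one_le (hA : Balanced ε ρ A) (hm : 1 ≤ m) (hε : 0 ≤ ε)
    (hρ : 0 ≤ ρ) (hρ1 : ρ ≤ 1) {p : EuclideanSpace ℝ (Fin k)} (hp : p ∈ simplex k) :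
    |∑ x, rescale ε A x * p x - 1| ≤ ρ := by
  have h : ∑ x, rescale ε A x * p x - 1 = ∑ x, (rescale ε A x - 1) * p x := by
    simp only [sub_mul, one_mul, Finset.sum_sub_distrib, hp.2]
  rw [h]
  calc _ ≤ ∑ x, |(rescale ε A x - 1) * p x| := Finset.abs_sum_le_sum_abs _ _
    _ ≤ ∑ x, ρ * p x := by
        refine Finset.sum_le_sum fun x _ => ?_
        rw [abs_mul, abs_of_nonneg (hp.1 x)]
        exact mul_le_mul_of_nonneg_right (hA.rescale_bounds hm hε hρ hρ1 x).1 (hp.1 x)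
    _ = ρ := by rw [← Finset.mul_sum, hp.2, mul_one]

theorem Balanced.norm_residual_le (hA : Balanced ε ρ A) (hm : 1 ≤ m) (hε : 1 / 2 ≤ ε)
    (hρ : 0 ≤ ρ) (hρ1 : ρ ≤ 1) {p : EuclideanSpace ℝ (Fin k)} (hp : p ∈ simplex k)
    (q : EuclideanSpace ℝ (Fin m)) :
    ‖app (sensing ε A) (rescaled ε A p) - measurement ε q‖ ≤
      9 * √(Real.exp (-ε) * m) * ‖q - outDist ε A p‖ + 9 * ρ := by
  have hε0 : 0 < ε := by linarith
  have hg0 := gain_nonneg hε0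
  have hg := gain_le hε
  have hg9 : gain ε ≤ 9 := by
    refine hg.trans ?_
    have : √(Real.exp (-ε)) ≤ 1 := Real.sqrt_le_one.mpr (Real.exp_le_one_iff.mpr (by linarith))
    linarith
  rw [norm_sub_rev, measurement_sub_app hm hε0 hA.1]
  refine (norm_add_le _ _).trans ?_
  rw [norm_smul, norm_smul, norm_const_inv_sqrt hm, mul_one, Real.norm_eq_abs, Real.norm_eq_abs,
    abs_mul, abs_mul, abs_of_nonneg hg0, abs_of_nonneg (Real.sqrt_nonneg _),
    Real.sqrt_mul (Real.exp_pos _).le]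
  have h1 := hA.abs_sum_rescale_sub_one_le hm hε0.le hρ hρ1 hp
  have h2 : gain ε * √(m : ℝ) ≤ 9 * (√(Real.exp (-ε)) * √(m : ℝ)) := by
    rw [← mul_assoc]
    gcongr
  gcongr

end Channel

/-! ### The error of the estimator -/

section Estimator

variable {m k n : ℕ} {ε ρ : ℝ} {A : Matrix (Fin m) (Fin k) ℝ}

theorem projSimplex_spec (hk : 1 ≤ k) (v : EuclideanSpace ℝ (Fin k)) :
    IsProj v (projSimplex v) := Classical.epsilon_spec (exists_isProj hk v)

theorem estimator_mem_simplex (R : Recovery) (hk : 1 ≤ k) (s : ℕ) (Y : Fin n → Fin m) :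
    estimator R s ε A Y ∈ simplex k := (projSimplex_spec hk _).1

/-- The triangle inequality suffices, since `p` itself competes in the projection. -/
theorem norm_sub_projSimplex_le (hk : 1 ≤ k) {p : EuclideanSpace ℝ (Fin k)} (hp : p ∈ simplex k)
    (v : EuclideanSpace ℝ (Fin k)) : ‖p - projSimplex v‖ ≤ 2 * ‖p - v‖ := by
  have h1 := (projSimplex_spec hk v).2 p hp
  have h2 := norm_sub_le_norm_sub_add_norm_sub p v (projSimplex v)
  rw [norm_sub_rev v p] at h1
  linarith

/-- The constant `480 = 120 · 2 · 2` collects the decoder, the inversion of `D'` and the projection.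
The bound `τ` must hold at every level in `[t₀, s]`, since any of them may be the one used. -/
theorem Balanced.norm_sub_estimator_le (hA : Balanced ε ρ A) (hm : 1 ≤ m) (hk : 1 ≤ k)
    (hε : 1 / 2 ≤ ε) (hρ : 0 ≤ ρ) (hρ1 : ρ ≤ 1) {s t₀ : ℕ} (hts : t₀ ≤ s)
    (hB : NullSpaceProp t₀ (sensing ε A)) {p : EuclideanSpace ℝ (Fin k)} (hp : p ∈ simplex k)
    {τ : ℝ} (hτ : ∀ t, t₀ ≤ t → t ≤ s → tailMass t p / √(t : ℝ) ≤ τ) (Y : Fin n → Fin m) :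
    ‖p - estimator adaptiveRecovery s ε A Y‖ ≤ 480 * (2 * τ + 9 * ρ) +
      4320 * √(Real.exp (-ε) * m) * ‖empirical Y - outDist ε A p‖ := by
  have hε0 : 0 ≤ ε := by linarith
  obtain ⟨t, ht1, ht2, ht⟩ := adaptiveRecovery_spec hts hB (measurement ε (empirical Y))
  set f := adaptiveRecovery m k (sensing ε A) (measurement ε (empirical Y)) s with hf
  have h1 := ht (rescaled ε A p)
  have h2 := hA.norm_residual_le hm hε hρ hρ1 hp (empirical Y)
  have h3 : tailMass t (rescaled ε A p) / √(t : ℝ) ≤ 2 * τ := by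
    have h4 : tailMass t (rescaled ε A p) ≤ 2 * tailMass t p := by
      refine tailMass_le_mul t fun i => ?_
      change |rescale ε A i * p i| ≤ _
      rw [abs_mul, abs_of_pos (rescale_pos hm hε0 i)]
      exact mul_le_mul_of_nonneg_right (hA.rescale_bounds hm hε0 hρ hρ1 i).2.1 (abs_nonneg _)
    calc _ ≤ 2 * tailMass t p / √(t : ℝ) := by gcongr
      _ = 2 * (tailMass t p / √(t : ℝ)) := by ring
      _ ≤ 2 * τ := by linarith [hτ t ht1 ht2]
  have h5 : ‖p - WithLp.toLp 2 fun i => (rescale ε A i)⁻¹ * f i‖ ≤ 2 * ‖rescaled ε A p - f‖ := by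
    refine le_of_sq_le_sq ?_ (by positivity)
    rw [mul_pow, EuclideanSpace.real_norm_sq_eq, EuclideanSpace.real_norm_sq_eq, Finset.mul_sum]
    refine Finset.sum_le_sum fun i _ => ?_
    have hr := rescale_pos (A := A) hm hε0 i
    have h6 : (p - WithLp.toLp 2 fun i => (rescale ε A i)⁻¹ * f i) i =
        (rescale ε A i)⁻¹ * (rescaled ε A p - f) i := by
      simp only [PiLp.sub_apply, rescaled]
      field_simp
    rw [h6, mul_pow]
    exact mul_le_mul_of_nonneg_right (pow_le_pow_left₀ (inv_pos.mpr hr).le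
      (hA.rescale_bounds hm hε0 hρ hρ1 i).2.2 2) (sq_nonneg _)
  have h7 := norm_sub_projSimplex_le hk hp (WithLp.toLp 2 fun i => (rescale ε A i)⁻¹ * f i)
  change ‖p - projSimplex (WithLp.toLp 2 fun i => (rescale ε A i)⁻¹ * f i)‖ ≤ _
  linarith

theorem outDist_nonneg (hm : 1 ≤ m) (hε : 0 ≤ ε) {p : EuclideanSpace ℝ (Fin k)}
    (hp : p ∈ simplex k) (y : Fin m) : 0 ≤ outDist ε A p y := by
  change 0 ≤ ∑ x, p x * channel ε A x y
  exact Finset.sum_nonneg fun x _ => mul_nonneg (hp.1 x) (channel_nonneg hm hε x y)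

theorem sum_outDist (hm : 1 ≤ m) (hε : 0 ≤ ε) {p : EuclideanSpace ℝ (Fin k)}
    (hp : p ∈ simplex k) : ∑ y, outDist ε A p y = 1 := by
  change ∑ y, ∑ x, p x * channel ε A x y = 1
  rw [Finset.sum_comm]
  simp only [← Finset.mul_sum, sum_channel hm hε, mul_one, hp.2]

/-- Summing out the `X_i` leaves `Y_1, …, Y_n` i.i.d. with law `outDist ε A p`. -/
theorem expectedError_eq_prodExp (R : Recovery) (s : ℕ)
    (d : EuclideanSpace ℝ (Fin k) → EuclideanSpace ℝ (Fin k) → ℝ)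
    (p : EuclideanSpace ℝ (Fin k)) :
    expectedError R s ε A d p n =
      prodExp (outDist ε A p) fun Y : Fin n → Fin m => d p (estimator R s ε A Y) := by
  unfold expectedError prodExp
  rw [Finset.sum_comm]
  refine Finset.sum_congr rfl fun Y _ => ?_
  rw [← Finset.sum_mul]
  congr 1
  change _ = ∏ i, ∑ x, p x * channel ε A x (Y i)
  rw [Finset.prod_univ_sum]
  simp

theorem prodExp_norm_empirical_sub_sq (hn : 1 ≤ n) {q : EuclideanSpace ℝ (Fin m)}
    (hq : ∑ y, q y = 1) :
    prodExp q (fun Y : Fin n → Fin m => ‖empirical Y - q‖ ^ 2) ≤ 1 / n := by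
  have hnpos : (0 : ℝ) < n := by exact_mod_cast hn
  set u : Fin m → EuclideanSpace ℝ (Fin m) := fun y => EuclideanSpace.single y 1 - q with hu
  have hsingle : ∑ y, q y • EuclideanSpace.single y (1 : ℝ) = q := by
    ext j
    rw [WithLp.ofLp_sum, Finset.sum_apply, Finset.sum_eq_single j]
    · simp
    · intro i _ hi
      simp [hi.symm]
    · simp
  have hmean : ∑ y, q y • u y = 0 := by
    simp only [hu, smul_sub, Finset.sum_sub_distrib, ← Finset.sum_smul, hq, one_smul, hsingle,
      sub_self]
  have hvar : ∑ y, q y * ‖u y‖ ^ 2 ≤ 1 := by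
    have h1 : ∀ y, q y * ‖u y‖ ^ 2 =
        q y + ‖q‖ ^ 2 * q y - 2 * inner ℝ (q y • EuclideanSpace.single y (1 : ℝ)) q := by
      intro y
      rw [hu, norm_sub_sq_real, real_inner_smul_left]
      simp
      ring
    simp only [h1, Finset.sum_sub_distrib, Finset.sum_add_distrib, ← Finset.mul_sum, hq,
      ← sum_inner, hsingle, real_inner_self_eq_norm_sq]
    nlinarith [sq_nonneg ‖q‖]
  have hemp : ∀ Y : Fin n → Fin m, ‖empirical Y - q‖ ^ 2 =
      (1 / (n : ℝ)) ^ 2 * ‖∑ i, u (Y i)‖ ^ 2 := by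
    intro Y
    have : empirical Y - q = (1 / (n : ℝ)) • ∑ i, u (Y i) := by
      ext y
      rw [PiLp.smul_apply, WithLp.ofLp_sum, Finset.sum_apply]
      simp only [hu, empirical, PiLp.sub_apply, PiLp.single_apply, Finset.sum_sub_distrib,
        Finset.sum_const, Finset.card_univ, Fintype.card_fin, nsmul_eq_mul, smul_eq_mul,
        Finset.sum_boole]
      rw [mul_sub, ← mul_assoc, one_div, inv_mul_cancel₀ hnpos.ne', one_mul]
      congr 1
      simp only [eq_comm (a := y)]
      ring
    rw [this, norm_smul, mul_pow, Real.norm_eq_abs, sq_abs]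
  simp only [hemp]
  rw [prodExp_const_mul, prodExp_norm_sum_sq hq, hmean]
  simp only [norm_zero, ne_eq, OfNat.ofNat_ne_zero, not_false_eq_true, zero_pow, mul_zero, add_zero]
  calc (1 / (n : ℝ)) ^ 2 * ((n : ℝ) * ∑ y, q y * ‖u y‖ ^ 2) ≤ (1 / (n : ℝ)) ^ 2 * ((n : ℝ) * 1) := by gcongr
    _ = 1 / (n : ℝ) := by field_simp

/-- In place of Jensen's inequality, `v ≤ 1/(2√n) + √n v²/2` linearizes the norm, and `E v² ≤ 1/n`
then gives `1/√n`. -/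
theorem expectedError_le (R : Recovery) (hm : 1 ≤ m) (hn : 1 ≤ n) (hε : 0 ≤ ε) (s : ℕ)
    {d : EuclideanSpace ℝ (Fin k) → EuclideanSpace ℝ (Fin k) → ℝ}
    {p : EuclideanSpace ℝ (Fin k)} (hp : p ∈ simplex k) {a b : ℝ} (hb : 0 ≤ b)
    (h : ∀ Y : Fin n → Fin m,
      d p (estimator R s ε A Y) ≤ a + b * ‖empirical Y - outDist ε A p‖) :
    expectedError R s ε A d p n ≤ a + b / √(n : ℝ) := by
  have hnpos : (0 : ℝ) < √(n : ℝ) := Real.sqrt_pos.mpr (by exact_mod_cast hn)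
  have hq := sum_outDist (A := A) hm hε hp
  rw [expectedError_eq_prodExp]
  have h1 : ∀ Y : Fin n → Fin m, d p (estimator R s ε A Y) ≤
      (a + b / (2 * √(n : ℝ))) + b * √(n : ℝ) / 2 * ‖empirical Y - outDist ε A p‖ ^ 2 := by
    intro Y
    refine (h Y).trans ?_
    set v := ‖empirical Y - outDist ε A p‖
    have h2 : v ≤ 1 / (2 * √(n : ℝ)) + √(n : ℝ) / 2 * v ^ 2 := by
      rw [← sub_nonneg]
      have : 1 / (2 * √(n : ℝ)) + √(n : ℝ) / 2 * v ^ 2 - v =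
          (√(n : ℝ) * v - 1) ^ 2 / (2 * √(n : ℝ)) := by
        field_simp
        ring
      rw [this]
      positivity
    have h3 := mul_le_mul_of_nonneg_left h2 hb
    calc a + b * v ≤ a + b * (1 / (2 * √(n : ℝ)) + √(n : ℝ) / 2 * v ^ 2) := by linarith
      _ = _ := by ring
  refine (prodExp_mono (outDist_nonneg hm hε hp) h1).trans ?_
  rw [prodExp_add, prodExp_const hq, prodExp_const_mul]
  have h4 := mul_le_mul_of_nonneg_left (prodExp_norm_empirical_sub_sq hn hq)
    (show 0 ≤ b * √(n : ℝ) / 2 by positivity)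
  have h5 : b * √(n : ℝ) / 2 * (1 / n) = b / (2 * √(n : ℝ)) := by
    nth_rewrite 2 [← Real.sq_sqrt (Nat.cast_nonneg (α := ℝ) n)]
    field_simp
  rw [h5] at h4
  have h6 : b / √(n : ℝ) = b / (2 * √(n : ℝ)) + b / (2 * √(n : ℝ)) := by
    field_simp
    norm_num
  linarith

/-- Since both vectors have total mass `1`, the mass of `q` outside the support `T` exceeds that of
`p` by at most the error on `T`, to which Cauchy–Schwarz applies. -/
theorem dist1_le_of_mem_simplex {s : ℕ} {p q : EuclideanSpace ℝ (Fin k)} (hp : p ∈ simplex k)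
    (hq : q ∈ simplex k) : dist1 p q ≤ 2 * √(s : ℝ) * ‖p - q‖ + 2 * tailMass s p := by
  obtain ⟨T, hT, htail⟩ := exists_tailMass_eq s p
  have h1 := sum_abs_le_sqrt_mul_norm hT (p - q)
  have h2 : ∑ i ∈ Tᶜ, |p i - q i| ≤ ∑ i ∈ Tᶜ, p i + ∑ i ∈ Tᶜ, q i := by
    rw [← Finset.sum_add_distrib]
    refine Finset.sum_le_sum fun i _ => abs_le.mpr ⟨?_, ?_⟩ <;> linarith [hp.1 i, hq.1 i]
  have h3 : tailMass s p = ∑ i ∈ Tᶜ, p i := by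
    rw [htail]
    exact Finset.sum_congr rfl fun i _ => abs_of_nonneg (hp.1 i)
  have h4 : ∑ i ∈ T, p i + ∑ i ∈ Tᶜ, p i = 1 := by rw [Finset.sum_add_sum_compl, hp.2]
  have h5 : ∑ i ∈ T, q i + ∑ i ∈ Tᶜ, q i = 1 := by rw [Finset.sum_add_sum_compl, hq.2]
  have h6 : ∑ i ∈ T, p i - ∑ i ∈ T, q i ≤ ∑ i ∈ T, |p i - q i| := by
    rw [← Finset.sum_sub_distrib]
    exact Finset.sum_le_sum fun i _ => le_abs_self _
  unfold dist1
  rw [← Finset.sum_add_sum_compl T]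
  simp only [PiLp.sub_apply] at h1
  linarith

end Estimator

/-! ### The random sign matrix as a finite product -/

/-- The real sign encoded by a Boolean. -/
def signOf (b : Bool) : ℝ := if b then 1 else -1

/-- The weights `e^{-ε}`, `1 - e^{-ε}` of the two signs. -/
def signWeight (ε : ℝ) (b : Bool) : ℝ := if b then Real.exp (-ε) else 1 - Real.exp (-ε)

/-- The weight of a row of independent signs. -/
def rowWeight {k : ℕ} (ε : ℝ) (row : Fin k → Bool) : ℝ := ∏ i, signWeight ε (row i)

/-- The real matrix encoded by a Boolean matrix. -/
def signMatrix {m k : ℕ} (f : Fin m → Fin k → Bool) : Fin m → Fin k → ℝ :=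
  fun r i => signOf (f r i)

/-- The centred and normalized sign. -/
def normSign (ε : ℝ) (b : Bool) : ℝ := (signOf b - signMean ε) / signStd ε

/-- `signWeight` as a measure. -/
def signMeasure (ε : ℝ) : Measure Bool :=
  ENNReal.ofReal (Real.exp (-ε)) • Measure.dirac true +
    ENNReal.ofReal (1 - Real.exp (-ε)) • Measure.dirac false

section Law

variable {m k : ℕ} {ε : ℝ}

theorem one_sub_exp_neg_nonneg (hε : 0 ≤ ε) : 0 ≤ 1 - Real.exp (-ε) :=
  sub_nonneg.mpr (Real.exp_le_one_iff.mpr (by linarith))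

theorem signWeight_nonneg (hε : 0 ≤ ε) (b : Bool) : 0 ≤ signWeight ε b := by
  unfold signWeight
  split_ifs
  · positivity
  · exact one_sub_exp_neg_nonneg hε

theorem sum_signWeight : ∑ b, signWeight ε b = 1 := by simp [signWeight]

theorem rowWeight_nonneg (hε : 0 ≤ ε) (row : Fin k → Bool) : 0 ≤ rowWeight ε row :=
  Finset.prod_nonneg fun _ _ => signWeight_nonneg hε _

theorem sum_rowWeight : ∑ row : Fin k → Bool, rowWeight ε row = 1 :=
  sum_prod_weights sum_signWeight

theorem isProbabilityMeasure_signMeasure (hε : 0 ≤ ε) :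
    IsProbabilityMeasure (signMeasure ε) := by
  constructor
  simp only [signMeasure, Measure.add_apply, Measure.smul_apply, measure_univ, smul_eq_mul,
    mul_one]
  rw [← ENNReal.ofReal_add (Real.exp_pos _).le (one_sub_exp_neg_nonneg hε)]
  simp

theorem signMeasure_singleton (b : Bool) :
    signMeasure ε {b} = ENNReal.ofReal (signWeight ε b) := by
  cases b <;> simp [signMeasure, signWeight]

theorem signLaw_eq_map : signLaw ε = (signMeasure ε).map signOf := by
  have h : Measurable signOf := measurable_of_finite _
  rw [signMeasure, Measure.map_add _ _ h, Measure.map_smul, Measure.map_smul,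
    Measure.map_dirac' h, Measure.map_dirac' h]
  simp [signLaw, signOf]

theorem matrixLaw_eq_map (hε : 0 ≤ ε) : matrixLaw m k ε =
    (Measure.pi fun _ : Fin m => Measure.pi fun _ : Fin k => signMeasure ε).map signMatrix := by
  have := isProbabilityMeasure_signMeasure hε
  have h : Measurable signOf := measurable_of_finite _
  have := Measure.isProbabilityMeasure_map (μ := signMeasure ε) h.aemeasurable
  have h1 : (Measure.pi fun _ : Fin k => signMeasure ε).map (fun row i => signOf (row i)) =
      Measure.pi fun _ : Fin k => signLaw ε := by
    rw [Measure.pi_map_pi fun _ => h.aemeasurable]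
    simp only [signLaw_eq_map]
  have h2 : Measurable fun (row : Fin k → Bool) i => signOf (row i) := measurable_of_finite _
  have := Measure.isProbabilityMeasure_map (μ := Measure.pi fun _ : Fin k => signMeasure ε)
    h2.aemeasurable
  have h3 := Measure.pi_map_pi (ι := Fin m) (μ := fun _ => Measure.pi fun _ : Fin k => signMeasure ε)
    (f := fun _ (row : Fin k → Bool) i => signOf (row i)) fun _ => h2.aemeasurable
  simp only [h1] at h3
  exact h3.symm

theorem isProbabilityMeasure_matrixLaw (hε : 0 ≤ ε) :
    IsProbabilityMeasure (matrixLaw m k ε) := by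
  have := isProbabilityMeasure_signMeasure hε
  rw [matrixLaw_eq_map hε]
  exact Measure.isProbabilityMeasure_map (measurable_of_finite _).aemeasurable

/-- `F` dominates the indicator of failure. No measurability of `S` is needed, as `matrixLaw` is the
image of a measure on a finite space and the image measure of any set is at least that of its
preimage. -/
theorem one_sub_prodExp_le_matrixLaw (hε : 0 ≤ ε) (S : Set (Fin m → Fin k → ℝ))
    {F : (Fin m → Fin k → Bool) → ℝ} (hF0 : ∀ f, 0 ≤ F f) (hF : ∀ f, signMatrix f ∉ S → 1 ≤ F f) :
    1 - prodExp (rowWeight ε) F ≤ (matrixLaw m k ε).real S := by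
  classical
  have := isProbabilityMeasure_signMeasure hε
  have hP := isProbabilityMeasure_matrixLaw (m := m) (k := k) hε
  set μ := Measure.pi fun _ : Fin m => Measure.pi fun _ : Fin k => signMeasure ε with hμ
  have hsing : ∀ f, μ.real {f} = ∏ r, rowWeight ε (f r) := by
    intro f
    rw [measureReal_def, hμ, Measure.pi_singleton, ENNReal.toReal_prod]
    refine Finset.prod_congr rfl fun r _ => ?_
    rw [Measure.pi_singleton, ENNReal.toReal_prod]
    refine Finset.prod_congr rfl fun i _ => ?_
    rw [signMeasure_singleton, ENNReal.toReal_ofReal (signWeight_nonneg hε _)]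
  have h1 : μ.real (signMatrix ⁻¹' S) ≤ (matrixLaw m k ε).real S := by
    refine ENNReal.toReal_mono (measure_ne_top _ _) ?_
    rw [matrixLaw_eq_map hε]
    exact Measure.le_map_apply (measurable_of_finite _).aemeasurable S
  refine le_trans ?_ h1
  have h2 : μ.real (signMatrix ⁻¹' S) =
      prodExp (rowWeight ε) fun f => if signMatrix f ∈ S then 1 else 0 := by
    have h3 : signMatrix ⁻¹' S =
        ((Finset.univ.filter fun f : Fin m → Fin k → Bool => signMatrix f ∈ S) : Set _) := by
      ext f
      simp only [Set.mem_preimage, Finset.coe_filter, Finset.mem_univ, true_and, Set.mem_ofPred_eq]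
    rw [h3, ← sum_measureReal_singleton, Finset.sum_filter]
    simp only [hsing, prodExp, mul_ite, mul_one, mul_zero]
  rw [h2, sub_le_iff_le_add, ← prodExp_add]
  refine (prodExp_const (n := m) (sum_rowWeight (k := k) (ε := ε)) 1).symm.le.trans ?_
  refine prodExp_mono (rowWeight_nonneg hε) fun f => ?_
  split_ifs with hf
  · linarith [hF0 f]
  · linarith [hF f hf]

end Law

/-! ### Concentration of the column counts -/

section Columns

variable {m k : ℕ} {ε : ℝ}

theorem sum_rowWeight_mul (x : Fin k) (h : Bool → ℝ) :
    ∑ row : Fin k → Bool, rowWeight ε row * h (row x) = ∑ b, signWeight ε b * h b := by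
  have h1 := prodExp_prod (w := signWeight ε) fun (i : Fin k) b => if i = x then h b else 1
  simp only [Finset.prod_ite_eq', Finset.mem_univ, if_true] at h1
  refine h1.trans ?_
  rw [Finset.prod_eq_single x]
  · simp
  · intro i _ hi
    simp only [hi, if_false, mul_one]
    exact sum_signWeight
  · simp

theorem colCount_signMatrix (f : Fin m → Fin k → Bool) (x : Fin k) :
    (colCount (signMatrix f) x : ℝ) = ∑ r, if f r x then 1 else 0 := by
  unfold colCount
  rw [Finset.sum_boole]
  congr 3
  ext r
  cases h : f r x <;> simp [signMatrix, signOf, h]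
  norm_num

/-- The sign of `l` selects the tail; the moment generating function uses `e^l ≤ 1 + l + l²` on
`[-1, 1]`. -/
theorem prodExp_colCount_chernoff (hε : 0 ≤ ε) (x : Fin k) {l u : ℝ} (hl : |l| ≤ 1)
    (P : (Fin m → Fin k → Bool) → Prop) [DecidablePred P]
    (hP : ∀ f, P f → u ≤ l * colCount (signMatrix f) x) :
    prodExp (rowWeight ε) (fun f => if P f then 1 else 0) ≤
      Real.exp (m * Real.exp (-ε) * (l + l ^ 2) - u) := by
  refine (prodExp_chernoff (rowWeight_nonneg hε) (fun row => l * if row x then 1 else 0)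
    (u := u) P fun f hf => ?_).trans ?_
  · rw [← Finset.mul_sum, ← colCount_signMatrix]
    exact hP f hf
  · have h1 : ∑ row : Fin k → Bool, rowWeight ε row * Real.exp (l * if row x then 1 else 0) ≤
        Real.exp (Real.exp (-ε) * (l + l ^ 2)) := by
      rw [sum_rowWeight_mul x fun b => Real.exp (l * if b then 1 else 0)]
      have h2 : Real.exp l ≤ 1 + l + l ^ 2 := by
        have := (abs_le.mp (Real.abs_exp_sub_one_sub_id_le hl)).2
        linarith
      have h3 := Real.add_one_le_exp (Real.exp (-ε) * (l + l ^ 2))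
      simp only [Fintype.sum_bool, signWeight, if_true, Bool.false_eq_true, if_false, mul_one,
        mul_zero, Real.exp_zero]
      nlinarith [mul_le_mul_of_nonneg_left h2 (Real.exp_pos (-ε)).le]
    refine (mul_le_mul_of_nonneg_left (pow_le_pow_left₀ (Finset.sum_nonneg fun row _ =>
      mul_nonneg (rowWeight_nonneg hε row) (Real.exp_pos _).le) h1 m)
      (Real.exp_pos _).le).trans (le_of_eq ?_)
    rw [← Real.exp_nat_mul, ← Real.exp_add]
    congr 1
    ring

theorem prodExp_colCount_deviation (hε : 0 ≤ ε) (x : Fin k) {ρ : ℝ} (hρ : 0 ≤ ρ) (hρ1 : ρ ≤ 1) :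
    prodExp (rowWeight ε) (fun f : Fin m → Fin k → Bool =>
      if ρ * (m * Real.exp (-ε)) < |(colCount (signMatrix f) x : ℝ) - m * Real.exp (-ε)|
        then 1 else 0) ≤ 2 * Real.exp (-(ρ ^ 2 * (m * Real.exp (-ε)) / 4)) := by
  classical
  set N := m * Real.exp (-ε) with hN
  have h1 := prodExp_colCount_chernoff (m := m) hε x (l := ρ / 2) (u := ρ / 2 * ((1 + ρ) * N))
    (by rw [abs_of_nonneg (by positivity)]; linarith)
    (fun f => (1 + ρ) * N < colCount (signMatrix f) x)
    (fun f hf => mul_le_mul_of_nonneg_left hf.le (by positivity))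
  have h2 := prodExp_colCount_chernoff (m := m) hε x (l := -(ρ / 2))
    (u := -(ρ / 2) * ((1 - ρ) * N))
    (by rw [abs_neg, abs_of_nonneg (by positivity)]; linarith)
    (fun f => colCount (signMatrix f) x < (1 - ρ) * N)
    (fun f hf => mul_le_mul_of_nonpos_left hf.le (by linarith))
  rw [← hN] at h1 h2
  have e1 : N * (ρ / 2 + (ρ / 2) ^ 2) - ρ / 2 * ((1 + ρ) * N) = -(ρ ^ 2 * N / 4) := by ring
  have e2 : N * (-(ρ / 2) + (-(ρ / 2)) ^ 2) - -(ρ / 2) * ((1 - ρ) * N) = -(ρ ^ 2 * N / 4) := by ring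
  rw [e1] at h1
  rw [e2] at h2
  rw [two_mul]
  refine le_trans ?_ (add_le_add h1 h2)
  rw [← prodExp_add]
  refine prodExp_mono (rowWeight_nonneg hε) fun f => ?_
  split_ifs with ha hb hc hc hb hc hc <;> norm_num
  rcases lt_abs.mp ha with h | h <;> linarith

end Columns

/-! ### Lower bounds on the sensing matrix -/

section Sensing

variable {m k : ℕ} {ε : ℝ}

theorem exp_neg_le (hε : 1 / 2 ≤ ε) : Real.exp (-ε) ≤ 8 / 13 := by
  rw [Real.exp_neg, inv_le_comm₀ (Real.exp_pos _) (by norm_num)]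
  have := Real.quadratic_le_exp_of_nonneg (show (0 : ℝ) ≤ ε by linarith)
  nlinarith

theorem signStd_sq (hε : 0 ≤ ε) :
    signStd ε ^ 2 = 4 * Real.exp (-ε) * (1 - Real.exp (-ε)) := by
  have h : 1 - signMean ε ^ 2 = 4 * Real.exp (-ε) * (1 - Real.exp (-ε)) := by
    unfold signMean
    ring
  rw [signStd, h, Real.sq_sqrt (mul_nonneg (by positivity) (one_sub_exp_neg_nonneg hε))]

theorem sum_signWeight_mul_normSign : ∑ b, signWeight ε b * normSign ε b = 0 := by
  simp only [Fintype.sum_bool, signWeight, normSign, signOf, signMean, if_true,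
    Bool.false_eq_true, if_false]
  ring

theorem sum_signWeight_mul_normSign_sq (hε : 1 / 2 ≤ ε) :
    ∑ b, signWeight ε b * normSign ε b ^ 2 = 1 := by
  have hq := exp_neg_le hε
  have hq0 := Real.exp_pos (-ε)
  have h1 : 1 - Real.exp (-ε) ≠ 0 := by linarith
  simp only [Fintype.sum_bool, signWeight, normSign, signOf, signMean, if_true,
    Bool.false_eq_true, if_false, div_pow, signStd_sq (show 0 ≤ ε by linarith)]
  field_simp
  ring

theorem sum_signWeight_mul_normSign_pow_four_le (hε : 1 / 2 ≤ ε) :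
    ∑ b, signWeight ε b * normSign ε b ^ 4 ≤
      1 / (Real.exp (-ε) * (1 - Real.exp (-ε))) := by
  have hq := exp_neg_le hε
  have hq0 := Real.exp_pos (-ε)
  have h1 : 0 < 1 - Real.exp (-ε) := by linarith
  have h4 : signStd ε ^ 4 = (4 * Real.exp (-ε) * (1 - Real.exp (-ε))) ^ 2 := by
    rw [← signStd_sq (show 0 ≤ ε by linarith)]
    ring
  simp only [Fintype.sum_bool, signWeight, normSign, signOf, signMean, if_true,
    Bool.false_eq_true, if_false, div_pow, h4]
  generalize Real.exp (-ε) = q at *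
  have e : q * ((1 - (2 * q - 1)) ^ 4 / (4 * q * (1 - q)) ^ 2) +
      (1 - q) * ((-1 - (2 * q - 1)) ^ 4 / (4 * q * (1 - q)) ^ 2) =
      ((1 - q) ^ 3 + q ^ 3) / (q * (1 - q)) := by
    field_simp
    ring
  rw [e]
  gcongr
  nlinarith

theorem norm_app_sensing_sq (f : Fin m → Fin k → Bool) (x : EuclideanSpace ℝ (Fin k)) :
    m * ‖app (sensing ε (signMatrix f)) x‖ ^ 2 = ∑ r, (∑ i, x i * normSign ε (f r i)) ^ 2 := by
  rcases Nat.eq_zero_or_pos m with rfl | hm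
  · simp
  have hmpos : (0 : ℝ) < m := by exact_mod_cast hm
  rw [norm_app_sq, Finset.mul_sum]
  refine Finset.sum_congr rfl fun r _ => ?_
  have : ∑ j, sensing ε (signMatrix f) r j * x j =
      1 / √(m : ℝ) * ∑ i, x i * normSign ε (f r i) := by
    rw [Finset.mul_sum]
    refine Finset.sum_congr rfl fun i _ => ?_
    unfold sensing signMatrix normSign
    ring
  rw [this, mul_pow, div_pow, Real.sq_sqrt hmpos.le]
  field_simp

/-- With `q = e^{-ε} ≤ 8/13` the fourth moment satisfies `3 + κ ≤ 6/q`, and `48 = 8 · 6`. -/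
theorem prodExp_sensing_lower_tail (hε : 1 / 2 ≤ ε) (x : EuclideanSpace ℝ (Fin k)) :
    prodExp (rowWeight ε) (fun f : Fin m → Fin k → Bool =>
      if ‖app (sensing ε (signMatrix f)) x‖ ^ 2 < 1 / 2 * ‖x‖ ^ 2 then 1 else 0) ≤
      Real.exp (-(m * Real.exp (-ε) / 48)) := by
  classical
  have hε0 : 0 ≤ ε := by linarith
  rcases Nat.eq_zero_or_pos m with rfl | hm
  · rw [Nat.cast_zero, zero_mul, zero_div, neg_zero, Real.exp_zero]
    refine le_trans ?_ (prodExp_const (n := 0) (sum_rowWeight (k := k) (ε := ε)) 1).le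
    refine prodExp_mono (rowWeight_nonneg hε0) fun f => ?_
    split_ifs <;> norm_num
  have hmpos : (0 : ℝ) < m := by exact_mod_cast hm
  have hq := exp_neg_le hε
  have hq0 := Real.exp_pos (-ε)
  have h1 : 0 < 1 - Real.exp (-ε) := by linarith
  refine (prodExp_lower_tail (signWeight_nonneg hε0) sum_signWeight sum_signWeight_mul_normSign
    (sum_signWeight_mul_normSign_sq hε) (by positivity)
    (sum_signWeight_mul_normSign_pow_four_le hε) (fun i => x i) _ fun f hf => ?_).trans ?_
  · rw [← norm_app_sensing_sq, ← EuclideanSpace.real_norm_sq_eq]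
    nlinarith
  · refine Real.exp_le_exp.mpr (neg_le_neg ?_)
    generalize Real.exp (-ε) = q at *
    have h2 : 3 + 1 / (q * (1 - q)) ≤ 6 / q := by
      rw [← sub_nonneg]
      have : 6 / q - (3 + 1 / (q * (1 - q))) = (6 * (1 - q) - 3 * q * (1 - q) - 1) / (q * (1 - q)) := by
        field_simp
        ring
      rw [this]
      refine div_nonneg ?_ (by positivity)
      nlinarith
    have h3 : m * q / 48 = m / (8 * (6 / q)) := by
      field_simp
      norm_num
    rw [h3]
    gcongr

/-- Bounds the diagonal term in Maurey's method. Balance gives at most `2mq` entries `+1`, where `q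
= e^{-ε}`, hence the bound `(q + 2)/(1 - q) ≤ 8`. -/
theorem Balanced.sum_sensing_sq_le {ρ : ℝ} {A : Matrix (Fin m) (Fin k) ℝ} (hA : Balanced ε ρ A)
    (hm : 1 ≤ m) (hε : 1 / 2 ≤ ε) (hρ1 : ρ ≤ 1) (j : Fin k) :
    ∑ r, sensing ε A r j ^ 2 ≤ 8 := by
  classical
  have hmpos : (0 : ℝ) < m := by exact_mod_cast hm
  have hq := exp_neg_le hε
  have hq0 := Real.exp_pos (-ε)
  have h1 : 0 < 1 - Real.exp (-ε) := by linarith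
  have hn : (colCount A j : ℝ) ≤ 2 * (m * Real.exp (-ε)) := by
    have h2 := (abs_le.mp (hA.2 j)).2
    have h3 : ρ * (m * Real.exp (-ε)) ≤ 1 * (m * Real.exp (-ε)) := by gcongr
    linarith
  have hcard : (colCount A j : ℝ) = ∑ r, if A r j = 1 then 1 else 0 := by
    rw [Finset.sum_boole]
    unfold colCount
    congr!
  have hterm : ∀ r, sensing ε A r j ^ 2 ≤ (4 * Real.exp (-ε) ^ 2 + 4 * if A r j = 1 then 1 else 0) /
      (m * (4 * Real.exp (-ε) * (1 - Real.exp (-ε)))) := by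
    intro r
    unfold sensing
    rw [mul_pow, div_pow, div_pow, Real.sq_sqrt hmpos.le, signStd_sq (by linarith), one_pow,
      div_mul_div_comm, one_mul]
    gcongr
    unfold signMean
    rcases hA.1 r j with h | h <;> rw [h] <;> norm_num <;> nlinarith
  refine (Finset.sum_le_sum fun r _ => hterm r).trans ?_
  rw [← Finset.sum_div, Finset.sum_add_distrib, ← Finset.mul_sum, ← Finset.mul_sum, ← hcard,
    div_le_iff₀ (by positivity)]
  simp only [Finset.sum_const, Finset.card_univ, Fintype.card_fin, nsmul_eq_mul]
  have h5 : 0 ≤ m * Real.exp (-ε) * (8 / 13 - Real.exp (-ε)) :=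
    mul_nonneg (by positivity) (by linarith)
  nlinarith [mul_pos hmpos hq0]

/-- A union bound over the `k` columns and the `(2k)^d` tuples of signed basis vectors. -/
theorem matrixLaw_good_ge (hm : 1 ≤ m) (hε : 1 / 2 ≤ ε) {ρ : ℝ} (hρ : 0 ≤ ρ) (hρ1 : ρ ≤ 1) {t : ℕ}
    (ht : 1 ≤ t) :
    1 - (k * (2 * Real.exp (-(ρ ^ 2 * (m * Real.exp (-ε)) / 4))) +
        (k * 2 : ℝ) ^ (128 * t + 1) * Real.exp (-(m * Real.exp (-ε) / 48))) ≤
      (matrixLaw m k ε).real {A | Balanced ε ρ A ∧ NullSpaceProp t (sensing ε A)} := by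
  classical
  have hε0 : 0 ≤ ε := by linarith
  set F₁ : Fin k → (Fin m → Fin k → Bool) → ℝ := fun x f =>
    if ρ * (m * Real.exp (-ε)) < |(colCount (signMatrix f) x : ℝ) - m * Real.exp (-ε)|
      then 1 else 0 with hF₁
  set F₂ : (Fin (128 * t + 1) → Fin k × Bool) → (Fin m → Fin k → Bool) → ℝ := fun τ f =>
    if ‖app (sensing ε (signMatrix f)) (∑ l, signedBasis (τ l))‖ ^ 2 <
      1 / 2 * ‖∑ l, signedBasis (τ l)‖ ^ 2 then 1 else 0 with hF₂
  have hF₁0 : ∀ x f, 0 ≤ F₁ x f := fun x f => by simp only [hF₁]; split_ifs <;> norm_num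
  have hF₂0 : ∀ τ f, 0 ≤ F₂ τ f := fun τ f => by simp only [hF₂]; split_ifs <;> norm_num
  have hs₁ : ∀ f, 0 ≤ ∑ x, F₁ x f := fun f => Finset.sum_nonneg fun x _ => hF₁0 x f
  have hs₂ : ∀ f, 0 ≤ ∑ τ, F₂ τ f := fun f => Finset.sum_nonneg fun τ _ => hF₂0 τ f
  refine le_trans ?_ (one_sub_prodExp_le_matrixLaw hε0 _
    (F := fun f => ∑ x, F₁ x f + ∑ τ, F₂ τ f) (fun f => add_nonneg (hs₁ f) (hs₂ f)) ?_)
  · rw [prodExp_add, prodExp_sum, prodExp_sum]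
    have h1 : ∑ x, prodExp (rowWeight ε) (F₁ x) ≤
        k * (2 * Real.exp (-(ρ ^ 2 * (m * Real.exp (-ε)) / 4))) := by
      refine (Finset.sum_le_sum fun x _ => prodExp_colCount_deviation hε0 x hρ hρ1).trans ?_
      simp
    have h2 : ∑ τ, prodExp (rowWeight ε) (F₂ τ) ≤
        (k * 2 : ℝ) ^ (128 * t + 1) * Real.exp (-(m * Real.exp (-ε) / 48)) := by
      refine (Finset.sum_le_sum fun τ _ => prodExp_sensing_lower_tail hε _).trans ?_
      simp
    linarith
  · intro f hf
    by_contra hlt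
    refine hf ?_
    have hlt' : ∑ x, F₁ x f + ∑ τ, F₂ τ f < 1 := not_le.mp hlt
    have hbal : Balanced ε ρ (signMatrix f) := by
      refine ⟨fun r x => ?_, fun x => ?_⟩
      · cases h : f r x <;> simp [signMatrix, signOf, h]
      · by_contra hx
        have h1 : F₁ x f = 1 := if_pos (not_le.mp hx)
        have h2 := Finset.single_le_sum (fun x _ => hF₁0 x f) (Finset.mem_univ x)
        linarith [hs₂ f]
    refine ⟨hbal, nullSpaceProp_of_lower_bound ht fun x => ?_⟩
    -- The choice `d - 1 = 128 t` makes `b/(d - 1) = 8/(128 t) = 1/(16 t)`, as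
    -- `nullSpaceProp_of_lower_bound` requires.
    have h3 := lower_bound_of_signedBasis (d := 128 * t + 1) (by omega)
      (B := sensing ε (signMatrix f)) (κ := 1 / 2) (b := 8) (by norm_num) (fun τ => by
        by_contra hτ
        have h1 : F₂ τ f = 1 := if_pos (not_le.mp hτ)
        have h2 := Finset.single_le_sum (fun τ _ => hF₂0 τ f) (Finset.mem_univ τ)
        linarith [hs₁ f]) (hbal.sum_sensing_sq_le hm hε hρ1) x
    refine h3.trans (le_of_eq ?_)
    have htpos : (0 : ℝ) < t := by exact_mod_cast ht
    push_cast
    field_simp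
    ring

end Sensing

/-! ### Sample complexity -/

/-- The sparsity at which recovery with accuracy `β` is possible and sufficient. -/
def targetLevel (s : ℕ) (β : ℝ) : ℕ := min s ⌈1920 ^ 2 / β ^ 2⌉₊

section Parameters

variable {m k s : ℕ} {ε η β δ : ℝ}

theorem one_le_targetLevel (hs : 1 ≤ s) (hβ : 0 < β) : 1 ≤ targetLevel s β :=
  le_min hs (Nat.one_le_ceil_iff.mpr (by positivity))

theorem targetLevel_le (s : ℕ) (β : ℝ) : targetLevel s β ≤ s := min_le_left _ _

theorem targetLevel_cast_le (hβ : 0 < β) (hβ2 : β ≤ 2) :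
    (targetLevel s β : ℝ) ≤ 2 * (1920 ^ 2 / β ^ 2) := by
  have h1 : (targetLevel s β : ℝ) ≤ ⌈(1920 : ℝ) ^ 2 / β ^ 2⌉₊ :=
    Nat.cast_le.mpr (Nat.min_le_right s _)
  have h2 := (Nat.ceil_lt_add_one (show (0 : ℝ) ≤ 1920 ^ 2 / β ^ 2 by positivity)).le
  have h3 : (1 : ℝ) ≤ 1920 ^ 2 / β ^ 2 := by
    rw [le_div_iff₀ (by positivity)]
    nlinarith
  linarith

theorem FitsInBits_clog (m : ℕ) : FitsInBits (Fin m) (Nat.clog 2 m) := by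
  have h : Fintype.card (Fin m) ≤ Fintype.card (Fin (Nat.clog 2 m) → Bool) := by
    simpa using Nat.le_pow_clog one_lt_two m
  obtain ⟨e⟩ := Function.Embedding.nonempty_of_card_le h
  exact ⟨e, e.injective⟩

/-- With `ℓ = log(k/δ)` and `k ≥ 2`, one has `2k ≤ e^{2ℓ}` and `e^{-ℓ} = δ/k ≤ δ/2`. Each of the two
failure probabilities is brought below `e^{-ℓ}`. -/
theorem matrixLaw_good_ge_one_sub (hm : 1 ≤ m) (hk : 2 ≤ k) (hs : 1 ≤ s) (hε : 1 / 2 ≤ ε)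
    (hη : 0 < η) (hη1 : η ≤ 1 / 2) (hβ : 0 < β) (hβ2 : β ≤ 2) (hδ : 0 < δ) (hδ1 : δ < 1)
    (hdim : 10 ^ 12 / η ^ 2 * (Real.exp ε * Real.log (k / δ) / β ^ 2) ≤ m) :
    1 - δ ≤ (matrixLaw m k ε).real {A | Balanced ε (η * β / 20000) A ∧
      NullSpaceProp (targetLevel s β) (sensing ε A)} := by
  have hk2 : (2 : ℝ) ≤ k := by exact_mod_cast hk
  have hkδ : (k : ℝ) ≤ k / δ := by
    rw [le_div_iff₀ hδ]
    nlinarith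
  set ℓ := Real.log (k / δ) with hℓ
  have hexp : Real.exp ℓ = k / δ := Real.exp_log (by positivity)
  have hℓ0 : 0 < ℓ := Real.log_pos (by linarith)
  set N := m * Real.exp (-ε) with hN
  have hNge : 10 ^ 12 / η ^ 2 * (ℓ / β ^ 2) ≤ N := by
    have h1 := mul_le_mul_of_nonneg_right hdim (Real.exp_pos (-ε)).le
    have h2 : Real.exp ε * Real.exp (-ε) = 1 := by rw [← Real.exp_add]; simp
    calc _ = 10 ^ 12 / η ^ 2 * (ℓ / β ^ 2) * (Real.exp ε * Real.exp (-ε)) := by rw [h2, mul_one]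
      _ = 10 ^ 12 / η ^ 2 * (Real.exp ε * ℓ / β ^ 2) * Real.exp (-ε) := by ring
      _ ≤ N := h1
  have h2k : (k : ℝ) * 2 ≤ Real.exp (2 * ℓ) := by
    rw [two_mul ℓ, Real.exp_add, hexp]
    nlinarith
  have hδ2 : Real.exp (-ℓ) ≤ δ / 2 := by
    rw [Real.exp_neg, hexp, inv_div, div_le_div_iff₀ (by linarith) (by norm_num)]
    nlinarith
  have hηβ : η * β ≤ 1 := by nlinarith
  have hρ0 : 0 ≤ η * β / 20000 := by positivity
  refine le_trans ?_ (matrixLaw_good_ge hm hε hρ0 (by linarith) (one_le_targetLevel hs hβ))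
  have hA : k * (2 * Real.exp (-((η * β / 20000) ^ 2 * N / 4))) ≤ δ / 2 := by
    have h1 : 3 * ℓ ≤ (η * β / 20000) ^ 2 * N / 4 := by
      have h2 := mul_le_mul_of_nonneg_left hNge (sq_nonneg (η * β / 20000))
      have h3 : (η * β / 20000) ^ 2 * (10 ^ 12 / η ^ 2 * (ℓ / β ^ 2)) = 2500 * ℓ := by
        field_simp
        norm_num
      rw [h3] at h2
      linarith
    calc _ = (k * 2) * Real.exp (-((η * β / 20000) ^ 2 * N / 4)) := by ring
      _ ≤ Real.exp (2 * ℓ) * Real.exp (-(3 * ℓ)) := by gcongr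
      _ = Real.exp (-ℓ) := by rw [← Real.exp_add]; ring_nf
      _ ≤ δ / 2 := hδ2
  have hB : (k * 2 : ℝ) ^ (128 * targetLevel s β + 1) * Real.exp (-(N / 48)) ≤ δ / 2 := by
    set d := 128 * targetLevel s β + 1 with hd
    have hd1 : (d : ℝ) ≤ 10 ^ 9 / β ^ 2 := by
      have h1 := targetLevel_cast_le (s := s) hβ hβ2
      have h2 : (1 : ℝ) ≤ targetLevel s β := by exact_mod_cast one_le_targetLevel hs hβ
      have h3 : (d : ℝ) = 128 * targetLevel s β + 1 := by rw [hd]; push_cast; ring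
      have h4 : 129 * (2 * ((1920 : ℝ) ^ 2 / β ^ 2)) ≤ 10 ^ 9 / β ^ 2 := by
        rw [← sub_nonneg]
        have : 10 ^ 9 / β ^ 2 - 129 * (2 * ((1920 : ℝ) ^ 2 / β ^ 2)) = 48908800 / β ^ 2 := by ring
        rw [this]
        positivity
      linarith
    have hd0 : (1 : ℝ) ≤ d := by rw [hd]; push_cast; linarith [(targetLevel s β).cast_nonneg (α := ℝ)]
    have hbig : 2 * d * ℓ + ℓ ≤ N / 48 := by
      have h1 : 4 * 10 ^ 12 * (ℓ / β ^ 2) ≤ N := by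
        refine le_trans ?_ hNge
        gcongr
        rw [le_div_iff₀ (by positivity)]
        nlinarith
      have h2 : d * ℓ ≤ 10 ^ 9 * (ℓ / β ^ 2) := by
        calc d * ℓ ≤ 10 ^ 9 / β ^ 2 * ℓ := by gcongr
          _ = _ := by ring
      have h3 : ℓ ≤ d * ℓ := by nlinarith
      have h4 : 0 ≤ ℓ / β ^ 2 := by positivity
      linarith
    calc _ ≤ Real.exp (2 * ℓ) ^ d * Real.exp (-(2 * d * ℓ + ℓ)) := by gcongr
      _ = Real.exp (-ℓ) := by
          rw [← Real.exp_nat_mul, ← Real.exp_add]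
          ring_nf
      _ ≤ δ / 2 := hδ2
  linarith

variable {A : Matrix (Fin m) (Fin k) ℝ}

theorem expectedError_dist2_le (hm : 1 ≤ m) (hk : 1 ≤ k) (hε : 1 / 2 ≤ ε) (hη : 0 < η)
    (hη1 : η ≤ 1 / 2) (hβ : 0 < β) (hβ2 : β ≤ 2) (hA : Balanced ε (η * β / 20000) A)
    (hB : NullSpaceProp (targetLevel s β) (sensing ε A)) {p : EuclideanSpace ℝ (Fin k)}
    (hp : p ∈ simplex k) {τ : ℝ}
    (hτ : ∀ t, targetLevel s β ≤ t → t ≤ s → tailMass t p / √(t : ℝ) ≤ τ) {n : ℕ}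
    (hn : 10 ^ 10 * (m / (Real.exp ε * β ^ 2)) ≤ n) :
    expectedError adaptiveRecovery s ε A dist2 p n ≤ 960 * τ + β / 2 ∧
      expectedError adaptiveRecovery s ε A dist1 p n ≤
        2 * √(s : ℝ) * (960 * τ + β / 2) + 2 * tailMass s p := by
  have hmpos : (0 : ℝ) < m := by exact_mod_cast hm
  have hε0 : 0 ≤ ε := by linarith
  have hn0 : (0 : ℝ) < n := lt_of_lt_of_le (by positivity) hn
  have hn1 : 1 ≤ n := by exact_mod_cast hn0
  have hρ0 : 0 ≤ η * β / 20000 := by positivity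
  have hρβ : η * β / 20000 ≤ β / 40000 := by nlinarith
  have hbound := fun Y : Fin n → Fin m => hA.norm_sub_estimator_le hm hk hε hρ0 (by linarith)
    (targetLevel_le s β) hB hp hτ Y
  set b := 4320 * √(Real.exp (-ε) * m) with hb
  have hb0 : 0 ≤ b := by positivity
  have hnoise : b / √(n : ℝ) ≤ 4320 * (β / 10 ^ 5) := by
    rw [hb, mul_div_assoc, ← Real.sqrt_div (by positivity)]
    refine mul_le_mul_of_nonneg_left (Real.sqrt_le_iff.mpr ⟨by positivity, ?_⟩) (by norm_num)
    rw [div_le_iff₀ hn0, Real.exp_neg]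
    calc _ = (β / 10 ^ 5) ^ 2 * (10 ^ 10 * (m / (Real.exp ε * β ^ 2))) := by
          field_simp
      _ ≤ _ := by gcongr
  -- Here `480 · 9 · β/40000 + 4320 · β/10^5 < β/2`, so bias and noise together use half of the
  -- accuracy.
  have htot : 480 * (2 * τ + 9 * (η * β / 20000)) + b / √(n : ℝ) ≤ 960 * τ + β / 2 := by
    linarith
  refine ⟨(expectedError_le adaptiveRecovery hm hn1 hε0 s hp hb0 hbound).trans htot, ?_⟩
  refine (expectedError_le adaptiveRecovery hm hn1 hε0 s hp
    (a := 2 * √(s : ℝ) * (480 * (2 * τ + 9 * (η * β / 20000))) + 2 * tailMass s p)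
    (b := 2 * √(s : ℝ) * b) (by positivity) fun Y => ?_).trans ?_
  · refine (dist1_le_of_mem_simplex (s := s) hp (estimator_mem_simplex _ hk s Y)).trans ?_
    have := mul_le_mul_of_nonneg_left (hbound Y) (show 0 ≤ 2 * √(s : ℝ) by positivity)
    linarith
  · have := mul_le_mul_of_nonneg_left htot (show 0 ≤ 2 * √(s : ℝ) by positivity)
    rw [mul_div_assoc (2 * √(s : ℝ)) b]
    linarith

theorem Balanced.achieves_dist2 (hm : 1 ≤ m) (hk : 1 ≤ k) (hs : 1 ≤ s) (hε : 1 / 2 ≤ ε)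
    (hη : 0 < η) (hη1 : η ≤ 1 / 2) (hβ : 0 < β) (hβ2 : β ≤ 2)
    (hA : Balanced ε (η * β / 20000) A)
    (hB : NullSpaceProp (targetLevel s β) (sensing ε A)) :
    Achieves adaptiveRecovery s ε A dist2 (IsSparse s)
        (10 ^ 10 * (m / (Real.exp ε * β ^ 2))) β ∧
      Achieves adaptiveRecovery s ε A dist2 (IsApproxSparse s (√(s : ℝ) * β))
        (10 ^ 10 * (m / (Real.exp ε * β ^ 2))) (2000 * β) := by
  have hspos : 0 < √(s : ℝ) := Real.sqrt_pos.mpr (by exact_mod_cast hs)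
  -- Below level `s` total mass `1` alone suffices; `1920 = 2 · 960` makes this contribution `β/2`
  -- in the final bound.
  have hsmall : ∀ p ∈ simplex k, ∀ t, targetLevel s β ≤ t → t < s →
      tailMass t p / √(t : ℝ) ≤ β / 1920 := by
    intro p hp t ht hts
    have h1 : tailMass t p ≤ 1 := by
      refine (tailMass_le_sum t p).trans (le_of_eq ?_)
      rw [← hp.2]
      exact Finset.sum_congr rfl fun i _ => abs_of_nonneg (hp.1 i)
    have h2 : (1920 : ℝ) ^ 2 / β ^ 2 ≤ t := by
      refine (Nat.le_ceil _).trans ?_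
      have : ⌈(1920 : ℝ) ^ 2 / β ^ 2⌉₊ ≤ t := by
        unfold targetLevel at ht
        omega
      exact_mod_cast this
    have h3 : 1920 / β ≤ √(t : ℝ) := by
      refine Real.le_sqrt_of_sq_le ?_
      rwa [div_pow]
    have h4 : 0 < 1920 / β := by positivity
    calc tailMass t p / √(t : ℝ) ≤ 1 / (1920 / β) :=
          div_le_div₀ zero_le_one h1 h4 h3
      _ = β / 1920 := by rw [one_div_div]
  constructor
  · intro p hp hsp n hn
    refine (expectedError_dist2_le hm hk hε hη hη1 hβ hβ2 hA hB hp (τ := β / 1920)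
      (fun t ht hts => ?_) hn).1.trans (by linarith)
    rcases hts.eq_or_lt with rfl | hlt
    · rw [tailMass_eq_zero hsp, zero_div]
      positivity
    · exact hsmall p hp t ht hlt
  · intro p hp hsp n hn
    refine (expectedError_dist2_le hm hk hε hη hη1 hβ hβ2 hA hB hp (τ := β)
      (fun t ht hts => ?_) hn).1.trans (by linarith)
    rcases hts.eq_or_lt with rfl | hlt
    · rw [div_le_iff₀ hspos, mul_comm]
      exact hsp
    · exact (hsmall p hp t ht hlt).trans (by linarith)

theorem Balanced.achieves_dist1 {α : ℝ} (hm : 1 ≤ m) (hk : 1 ≤ k) (hs : 1 ≤ s) (hε : 1 / 2 ≤ ε)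
    (hη : 0 < η) (hη1 : η ≤ 1 / 2) (hα : 0 < α) (hα2 : α ≤ 2)
    (hA : Balanced ε (η * (1 / √(s : ℝ) * α) / 20000) A)
    (hB : NullSpaceProp (targetLevel s (1 / √(s : ℝ) * α)) (sensing ε A)) :
    Achieves adaptiveRecovery s ε A dist1 (IsSparse s)
        (10 ^ 10 * (s * m / (Real.exp ε * α ^ 2))) α ∧
      Achieves adaptiveRecovery s ε A dist1 (IsApproxSparse s α)
        (10 ^ 10 * (s * m / (Real.exp ε * α ^ 2))) (2000 * α) := by
  have hs1 : (1 : ℝ) ≤ s := by exact_mod_cast hs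
  have hsqrt1 : 1 ≤ √(s : ℝ) := Real.one_le_sqrt.mpr hs1
  have hspos : 0 < √(s : ℝ) := by linarith
  have hsq : √(s : ℝ) ^ 2 = s := Real.sq_sqrt (by linarith)
  set β := 1 / √(s : ℝ) * α with hβdef
  have hβ : 0 < β := by positivity
  have hsβ : √(s : ℝ) * β = α := by rw [hβdef]; field_simp
  have hβ2 : β ≤ 2 := by nlinarith
  -- For `β = α/√s` with `α ≤ 2`, the cap `1920²/β² = 1920² s/α²` exceeds `s`.
  have hlevel : targetLevel s β = s := by
    refine min_eq_left ?_
    have h1 : (s : ℝ) ≤ 1920 ^ 2 / β ^ 2 := by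
      rw [le_div_iff₀ (by positivity), ← hsq, ← mul_pow, hsβ]
      nlinarith
    exact_mod_cast h1.trans (Nat.le_ceil _)
  have hNeq : (s * m / (Real.exp ε * α ^ 2) : ℝ) = m / (Real.exp ε * β ^ 2) := by
    rw [← hsβ, mul_pow, hsq]
    field_simp
  rw [hNeq]
  constructor
  · intro p hp hsp n hn
    refine (expectedError_dist2_le hm hk hε hη hη1 hβ hβ2 hA hB hp (τ := 0)
      (fun t ht hts => ?_) hn).2.trans ?_
    · rw [hlevel] at ht
      rw [le_antisymm hts ht, tailMass_eq_zero hsp, zero_div]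
    · rw [tailMass_eq_zero hsp]
      linarith
  · intro p hp hsp n hn
    have hsp' : tailMass s p ≤ α := hsp
    refine (expectedError_dist2_le hm hk hε hη hη1 hβ hβ2 hA hB hp (τ := β)
      (fun t ht hts => ?_) hn).2.trans ?_
    · rw [hlevel] at ht
      rw [le_antisymm hts ht, div_le_iff₀ hspos, mul_comm, hsβ]
      exact hsp'
    · nlinarith

theorem expectedError_eq_zero_of_card_one (R : Recovery) {d : EuclideanSpace ℝ (Fin 1) →
    EuclideanSpace ℝ (Fin 1) → ℝ} (hd : ∀ x, d x x = 0) {A : Matrix (Fin m) (Fin 1) ℝ}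
    {p : EuclideanSpace ℝ (Fin 1)} (hp : p ∈ simplex 1) (n : ℕ) :
    expectedError R s ε A d p n = 0 := by
  have h : ∀ Y : Fin n → Fin m, estimator R s ε A Y = p := by
    intro Y
    have h1 := (estimator_mem_simplex R le_rfl (ε := ε) (A := A) s Y).2
    have h2 := hp.2
    rw [Fin.sum_univ_one] at h1 h2
    ext i
    rw [Subsingleton.elim i 0, h1, h2]
  simp [expectedError, h, hd]

end Parameters

end CompressivePrivatization

end

theorem mainTheorem4 :
    ∃ (R : Recovery) (C D : ℝ), 0 < C ∧ 0 < D ∧ R.IsStable C D ∧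
      ∀ η : ℝ, 0 < η → η ≤ 1 / 2 →
        ∃ (K L M : ℝ), 0 < K ∧ 0 < L ∧ 0 < M ∧
          ∀ (m k s : ℕ) (ε δ α : ℝ), 1 ≤ s → s ≤ k → 0 < δ → δ < 1 → 0 < α → α ≤ 2 →
            1 - η ≤ ε → ε ≤ Real.log m →
            -- the `ℓ₂` result, with `c = 1`
            (K * dimBound k s ε δ α 1 ≤ m →
              1 - δ - Real.exp (-(m : ℝ)) ≤ (matrixLaw m k ε).real {A |
                IsLDP (channel ε A) (ε + η) ∧
                FitsInBits (Fin m) (Nat.clog 2 m) ∧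
                Achieves R s ε A dist2 (IsSparse s) (L * (m / (Real.exp ε * α ^ 2))) α ∧
                Achieves R s ε A dist2 (IsApproxSparse s (√(s : ℝ) * α))
                  (L * (m / (Real.exp ε * α ^ 2))) (M * α)}) ∧
            -- the `ℓ₁` result, with `c = 1 / √s`
            (K * dimBound k s ε δ α (1 / √(s : ℝ)) ≤ m →
              1 - δ - Real.exp (-(m : ℝ)) ≤ (matrixLaw m k ε).real {A |
                IsLDP (channel ε A) (ε + η) ∧
                FitsInBits (Fin m) (Nat.clog 2 m) ∧
                Achieves R s ε A dist1 (IsSparse s) (L * (s * m / (Real.exp ε * α ^ 2))) α ∧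
                Achieves R s ε A dist1 (IsApproxSparse s α)
                  (L * (s * m / (Real.exp ε * α ^ 2))) (M * α)}) := by
  refine ⟨adaptiveRecovery, 120, 120, by norm_num, by norm_num, adaptiveRecovery_isStable,
    fun η hη hη1 => ⟨10 ^ 12 / η ^ 2, 10 ^ 10, 2000, by positivity, by norm_num, by norm_num,
      fun m k s ε δ α hs hsk hδ hδ1 hα hα2 hηε hεm => ?_⟩⟩
  have hε : 1 / 2 ≤ ε := by linarith
  have hε0 : 0 ≤ ε := by linarith
  have hm : 1 ≤ m := by
    by_contra h
    have : m = 0 := by omega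
    subst this
    -- For `m = 0` the convention `log 0 = 0` contradicts `1/2 ≤ ε ≤ log m`.
    rw [Nat.cast_zero, Real.log_zero] at hεm
    linarith
  have hk : 1 ≤ k := hs.trans hsk
  have hem := Real.exp_pos (-(m : ℝ))
  have hprob := isProbabilityMeasure_matrixLaw (m := m) (k := k) hε0
  rcases hk.eq_or_lt with rfl | hk2
  -- For `k = 1` the quantity `log(k/δ)` may be arbitrarily small, so concentration is unavailable.
  -- But the simplex is a single point and there is only one column, so every matrix works.
  · have htriv : ∀ (d : EuclideanSpace ℝ (Fin 1) → EuclideanSpace ℝ (Fin 1) → ℝ)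
        (P P' : EuclideanSpace ℝ (Fin 1) → Prop) (N : ℝ), (∀ x, d x x = 0) →
        1 - δ - Real.exp (-(m : ℝ)) ≤ (matrixLaw m 1 ε).real {A |
          IsLDP (channel ε A) (ε + η) ∧ FitsInBits (Fin m) (Nat.clog 2 m) ∧
          Achieves adaptiveRecovery s ε A d P N α ∧
          Achieves adaptiveRecovery s ε A d P' N (2000 * α)} := by
      intro d P P' N hd
      have huniv : {A : Fin m → Fin 1 → ℝ |
          IsLDP (channel ε A) (ε + η) ∧ FitsInBits (Fin m) (Nat.clog 2 m) ∧
          Achieves adaptiveRecovery s ε A d P N α ∧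
          Achieves adaptiveRecovery s ε A d P' N (2000 * α)} = Set.univ := by
        refine Set.eq_univ_of_forall fun A => ⟨isLDP_of_colWeight_le hm hε0 fun x x' => ?_,
          FitsInBits_clog m, fun p hp _ n _ => ?_, fun p hp _ n _ => ?_⟩
        · rw [Subsingleton.elim x' x]
          exact le_mul_of_one_le_left (colWeight_pos hm hε0 x).le (Real.one_le_exp hη.le)
        · exact (expectedError_eq_zero_of_card_one _ hd hp n).le.trans hα.le
        · exact (expectedError_eq_zero_of_card_one _ hd hp n).le.trans (by positivity)
      rw [huniv, probReal_univ]
      linarith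
    exact ⟨fun _ => htriv dist2 _ _ _ fun x => by simp [dist2],
      fun _ => htriv dist1 _ _ _ fun x => by simp [dist1]⟩
  · have hdim : ∀ c : ℝ, 10 ^ 12 / η ^ 2 * dimBound k s ε δ α c ≤ m →
        10 ^ 12 / η ^ 2 * (Real.exp ε * Real.log (k / δ) / (c * α) ^ 2) ≤ m := by
      intro c h
      refine le_trans ?_ h
      rw [mul_pow]
      gcongr
      exact (le_max_right _ _).trans (le_max_left _ _)
    have hldp : ∀ {β : ℝ} {A : Matrix (Fin m) (Fin k) ℝ}, 0 < β → β ≤ 2 →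
        Balanced ε (η * β / 20000) A → IsLDP (channel ε A) (ε + η) := by
      intro β A hβ hβ2 hA
      have : η * β ≤ η * 2 := by gcongr
      exact hA.isLDP hm hε0 (by positivity) (by linarith) (by linarith)
    constructor
    · intro h
      have h1 := hdim 1 h
      rw [one_mul] at h1
      have h2 := matrixLaw_good_ge_one_sub hm hk2 hs hε hη hη1 hα hα2 hδ hδ1 h1
      refine le_trans (by linarith) (h2.trans (measureReal_mono fun A hA => ?_))
      obtain ⟨h3, h4⟩ := hA.1.achieves_dist2 hm hk hs hε hη hη1 hα hα2 hA.2
      exact ⟨hldp hα hα2 hA.1, FitsInBits_clog m, h3, h4⟩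
    · intro h
      have hsqrt1 : 1 ≤ √(s : ℝ) := Real.one_le_sqrt.mpr (by exact_mod_cast hs)
      have hβ : 0 < 1 / √(s : ℝ) * α := by positivity
      have hβ2 : 1 / √(s : ℝ) * α ≤ 2 := by
        rw [one_div_mul_eq_div, div_le_iff₀ (by linarith)]
        nlinarith
      have h2 := matrixLaw_good_ge_one_sub hm hk2 hs hε hη hη1 hβ hβ2 hδ hδ1 (hdim _ h)
      refine le_trans (by linarith) (h2.trans (measureReal_mono fun A hA => ?_))
      obtain ⟨h3, h4⟩ := hA.1.achieves_dist1 hm hk hs hε hη hη1 hα hα2 hA.2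
      exact ⟨hldp hβ hβ2 hA.1, FitsInBits_clog m, h3, h4⟩
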